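/- Let $(X,\mu)$ be a non-atomic probability space (every measurable set of positive measure contains a measurable subset of strictly smaller positive measure) and let $T:X\to X$ be an ergodic automorphism of it, i.e. a bijection, measurable with measurable inverse, that preserves $\mu$ and is ergodic. Let $L^\infty(X,\mathrm{SL}(2,\mathbb R))$ be the set of measurable, essentially bounded maps $A:X\to\mathrm{SL}(2,\mathbb R)$ (called cocycles, and identified when they agree $\mu$-a.e.), with the metric $\|A-B\|_\infty=\operatorname{ess\,sup}_x\|A(x)-B(x)\|$, where $\|\cdot\|$ is the Euclidean operator norm. For $n>0$ put $A^n(x)=A(T^{n-1}x)\cdots A(x)$, $A^0(x)=I$ and $A^{-n}(x)=[A(T^{-n}x)]^{-1}\cdots[A(T^{-1}x)]^{-1}$. The integrated Lyapunov exponent of $A$ is $$\mathrm{LE}(A)=\int_X\lambda^+\,d\mu,\qquad \lambda^+(x)=\lim_{n\to+\infty}\frac1n\log\|A^n(x)\|\ \text{ (the limit exists for a.e. } x).$$ The cocycle $A$ is uniformly hyperbolic if for a.e. $x\in X$ there is a splitting $\mathbb R^2=E^u(x)\oplus E^s(x)$, depending measurably on $x$, such that $A(x)E^u(x)=E^u(Tx)$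 and $A(x)E^s(x)=E^s(Tx)$ for a.e. $x$, and there are constants $C>0$ and $0<\tau<1$ such that, for a.e. $x\in X$ and all $n\ge 0$, $\|A^n(x)v^s\|\le C\tau^n\|v^s\|$ for all $v^s\in E^s(x)$ and $\|A^{-n}(x)v^u\|\le C\tau^n\|v^u\|$ for all $v^u\in E^u(x)$. Then there is a residual set $\mathcal R\subset L^\infty(X,\mathrm{SL}(2,\mathbb R))$ (a set containing a countable intersection of dense open sets) such that every $A\in\mathcal R$ is uniformly hyperbolic or satisfies $\mathrm{LE}(A)=0$. -/

import Mathlib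

open MeasureTheory Filter Topology
open scoped MatrixGroups Matrix.Norms.L2Operator ENNReal

namespace SLCocycle

/-- A measure is non-atomic if every measurable set of positive measure contains a measurable
subset of positive and strictly smaller measure. (On a general measurable space this is stronger
than asking that points have measure zero.) -/
def IsNonatomic {X : Type*} [MeasurableSpace X] (μ : Measure X) : Prop :=
  ∀ s : Set X, MeasurableSet s → 0 < μ s →
    ∃ t : Set X, t ⊆ s ∧ MeasurableSet t ∧ 0 < μ t ∧ μ t < μ s

/-- The space `L^∞(X, SL(2,ℝ))`: classes modulo `μ`-a.e. equality of measurable, essentially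
bounded maps `X → SL(2,ℝ)`. The norm of a matrix is its Euclidean operator norm. -/
structure LinftySL {X : Type*} [MeasurableSpace X] (μ : Measure X) where
  /-- the underlying class of maps -/
  toAEEqFun : X →ₘ[μ] SL(2, ℝ)
  /-- essential boundedness -/
  ess_bounded : ∃ C : ℝ, ∀ᵐ x ∂μ, ‖(toAEEqFun x : Matrix (Fin 2) (Fin 2) ℝ)‖ ≤ C

section metric

variable {X : Type*} [MeasurableSpace X] {μ : Measure X}

/-- A cocycle as a function, through a representative with values in `SL(2,ℝ)` everywhere. -/
noncomputable instance : CoeFun (LinftySL μ) (fun _ => X → SL(2, ℝ)) :=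
  ⟨fun A => A.toAEEqFun⟩

theorem LinftySL.ext_ae {A B : LinftySL μ} (h : ∀ᵐ x ∂μ, A x = B x) : A = B := by
  cases A; cases B
  congr
  exact AEEqFun.ext h

/-- The distance `ess sup ‖A(x) - B(x)‖`. -/
noncomputable instance : Dist (LinftySL μ) :=
  ⟨fun A B => (essSup (fun x =>
    ‖(A x : Matrix (Fin 2) (Fin 2) ℝ) - (B x : Matrix (Fin 2) (Fin 2) ℝ)‖ₑ) μ).toReal⟩

theorem LinftySL.dist_def (A B : LinftySL μ) :
    dist A B = (eLpNormEssSup (fun x =>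
      (A x : Matrix (Fin 2) (Fin 2) ℝ) - (B x : Matrix (Fin 2) (Fin 2) ℝ)) μ).toReal := rfl

theorem LinftySL.essSup_ne_top (A B : LinftySL μ) :
    eLpNormEssSup (fun x =>
      (A x : Matrix (Fin 2) (Fin 2) ℝ) - (B x : Matrix (Fin 2) (Fin 2) ℝ)) μ ≠ ∞ := by
  obtain ⟨C, hC⟩ := A.ess_bounded
  obtain ⟨D, hD⟩ := B.ess_bounded
  refine (eLpNormEssSup_lt_top_of_ae_bound (C := C + D) ?_).ne
  filter_upwards [hC, hD] with x h1 h2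
  exact (norm_sub_le _ _).trans (add_le_add h1 h2)

noncomputable instance : MetricSpace (LinftySL μ) where
  dist_self A := by simp [LinftySL.dist_def, ← Pi.zero_def]
  dist_comm A B := by
    rw [LinftySL.dist_def, LinftySL.dist_def]
    congr 1
    exact essSup_congr_ae (Eventually.of_forall fun x => enorm_sub_rev _ _)
  dist_triangle A B C := by
    rw [LinftySL.dist_def, LinftySL.dist_def, LinftySL.dist_def,
      ← ENNReal.toReal_add (LinftySL.essSup_ne_top _ _) (LinftySL.essSup_ne_top _ _)]
    refine ENNReal.toReal_mono
      (ENNReal.add_ne_top.2 ⟨LinftySL.essSup_ne_top _ _, LinftySL.essSup_ne_top _ _⟩) ?_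
    refine le_trans (le_of_eq ?_) (eLpNormEssSup_add_le (μ := μ))
    congr 1
    funext x
    simp
  eq_of_dist_eq_zero {A B} h := by
    rw [LinftySL.dist_def, ENNReal.toReal_eq_zero_iff, or_iff_left (LinftySL.essSup_ne_top _ _),
      eLpNormEssSup_eq_zero_iff] at h
    refine LinftySL.ext_ae ?_
    filter_upwards [h] with x hx
    exact Subtype.ext (sub_eq_zero.1 hx)

end metric

section dynamics

variable {X : Type*} [MeasurableSpace X]

/-- `A(T^{n-1} x) ⋯ A(x)`, for `n ≥ 0`. -/
def iterFwd (T : X ≃ᵐ X) (A : X → SL(2, ℝ)) : ℕ → X → SL(2, ℝ)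
  | 0, _ => 1
  | n + 1, x => A (T^[n] x) * iterFwd T A n x

/-- `A(T^{-n} x)⁻¹ ⋯ A(T^{-1} x)⁻¹`, for `n ≥ 0`. -/
def iterBwd (T : X ≃ᵐ X) (A : X → SL(2, ℝ)) : ℕ → X → SL(2, ℝ)
  | 0, _ => 1
  | n + 1, x => (A (T.symm^[n + 1] x))⁻¹ * iterBwd T A n x

/-- The iterates `A^n(x)`, `n ∈ ℤ`, of the cocycle `A` over `T`. -/
def iter (T : X ≃ᵐ X) (A : X → SL(2, ℝ)) : ℤ → X → SL(2, ℝ)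
  | Int.ofNat n, x => iterFwd T A n x
  | Int.negSucc n, x => iterBwd T A (n + 1) x

/-- The linear action of `SL(2,ℝ)` on the Euclidean plane. -/
noncomputable def act (M : SL(2, ℝ)) :
    EuclideanSpace ℝ (Fin 2) →ₗ[ℝ] EuclideanSpace ℝ (Fin 2) :=
  Matrix.toEuclideanLin (M : Matrix (Fin 2) (Fin 2) ℝ)

/-- A field `x ↦ E(x)` of subspaces of the plane depends (a.e.-)measurably on `x` if the
orthogonal projection onto `E(x)` does. -/
def AEMeasurableField (μ : Measure X) (E : X → Submodule ℝ (EuclideanSpace ℝ (Fin 2))) : Prop :=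
  ∀ v : EuclideanSpace ℝ (Fin 2), AEMeasurable (fun x => (E x).starProjection v) μ

/-- Uniform hyperbolicity of the cocycle `A` over `T`. -/
def IsUniformlyHyperbolic (μ : Measure X) (T : X ≃ᵐ X) (A : X → SL(2, ℝ)) : Prop :=
  ∃ Eu Es : X → Submodule ℝ (EuclideanSpace ℝ (Fin 2)),
    AEMeasurableField μ Eu ∧ AEMeasurableField μ Es ∧
    (∀ᵐ x ∂μ, IsCompl (Eu x) (Es x)) ∧
    (∀ᵐ x ∂μ, (Eu x).map (act (A x)) = Eu (T x) ∧ (Es x).map (act (A x)) = Es (T x)) ∧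
    ∃ C τ : ℝ, 0 < C ∧ 0 < τ ∧ τ < 1 ∧
      ∀ᵐ x ∂μ, ∀ n : ℕ,
        (∀ v ∈ Es x, ‖act (iter T A n x) v‖ ≤ C * τ ^ n * ‖v‖) ∧
        (∀ v ∈ Eu x, ‖act (iter T A (-(n : ℤ)) x) v‖ ≤ C * τ ^ n * ‖v‖)

/-- `LE(A) = L`: the upper Lyapunov exponent
`lam x = lim_{n → ∞} (1/n) log ‖A^n(x)‖` exists for a.e. `x`, is integrable, and has
integral `L`. -/
def HasLE (μ : Measure X) (T : X ≃ᵐ X) (A : X → SL(2, ℝ)) (L : ℝ) : Prop :=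
  ∃ lam : X → ℝ,
    (∀ᵐ x ∂μ, Tendsto
      (fun n : ℕ => (1 / (n : ℝ)) * Real.log ‖(iter T A n x : Matrix (Fin 2) (Fin 2) ℝ)‖)
      atTop (𝓝 (lam x))) ∧
    Integrable lam μ ∧ ∫ x, lam x ∂μ = L

end dynamics

end SLCocycle

/-!
Genericity of zero exponents for bounded measurable `SL(2,ℝ)`-cocycles.

For `ε > 0` let `U ε` be the set of cocycles `A` with `∫ log ‖A^n‖ dμ < n ε` for some `n ≥ 1`. It is
open (`isOpen_growth_lt`), so `U ε ∪ (closure (U ε))ᶜ` is open and dense, and `R` is the intersection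
of these sets over `ε = 1 / (m + 1)`. A cocycle that belongs to every `U ε` has zero exponent: the
maximal ergodic inequality, applied to `T^N` and `log ‖A^N‖`, bounds the measure of the points where
`log ‖A^n‖` is at some time much larger than `n ε` (`hasLE_zero_of_growth_lt`). It remains to show
that a cocycle `A` that is not uniformly hyperbolic lies in the closure of every `U ε`
(`exists_dist_lt_growth_lt`).

The perturbations of `A` have the form `R_{θ(x)} A(x)`, where `R_θ` is the rotation of angle `θ` and
`|θ| ≤ δ`. Along an orbit segment, start with a direction `u` and consider the directions reached
from it under all such perturbations. If some direction is not reached, the reached directions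
contain, at each step, the arc between the two extreme orbits, whose length stays below `π`
(`wedge_arcEnd_pos`). These arcs are cones that `A` maps into each other with a margin `δ` on both
sides. The quadratic form vanishing on the two sides of a cone then increases along every orbit
`(v_i)` by at least `η |v_i|²` per step, so that `∑ |v_i|² ≤ K (|v_0|² + |v_k|²)` with `K` depending
only on `δ` and `‖A‖_∞` (`sum_norm_sq_le_of_not_reach`). If this inequality holds at almost every
point and for every length, then `A` is uniformly hyperbolic: a half-orbit that tends to zero does so
exponentially, such half-orbits exist in both time directions by compactness, and no nonzero vector
tends to zero in both (`isUniformlyHyperbolic_of_endControl`).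

So if `A` is not uniformly hyperbolic, then for some `k` there is a set of positive measure of
points from which every direction can be sent to every direction in `k` steps. By ergodicity such
points are frequent along most long orbit segments. Choose one that splits the segment into two
parts whose products have comparable norms, and send the image of the direction most expanded by
the first part to the direction most contracted by the second: the norm of the whole product
becomes smaller than `e^{ε N}` (`exists_rotated_opNorm_le`). Doing this along the columns of a
Rokhlin tower that fills most of the space (`exists_isTowerBase_subset`) gives a nearby cocycle
in `U ε`.
-/

namespace SLCocycle

/-! ### Linear algebra of the plane -/

/-- The Euclidean plane. -/
abbrev Plane := EuclideanSpace ℝ (Fin 2)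

/-- The Euclidean operator norm of an element of `SL(2,ℝ)`. -/
noncomputable abbrev opNorm (M : SL(2, ℝ)) : ℝ := ‖(M : Matrix (Fin 2) (Fin 2) ℝ)‖

/-- The area form `u ∧ v` of the plane. -/
def wedge (u v : Plane) : ℝ := u 0 * v 1 - u 1 * v 0

/-- The Euclidean inner product of the plane, in coordinates. -/
def dot (u v : Plane) : ℝ := u 0 * v 0 + u 1 * v 1

theorem norm_sq_plane (v : Plane) : ‖v‖ ^ 2 = v 0 ^ 2 + v 1 ^ 2 := by
  simp [EuclideanSpace.norm_sq_eq]

theorem act_zero_coord (M : SL(2, ℝ)) (v : Plane) : act M v 0 = M 0 0 * v 0 + M 0 1 * v 1 := by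
  simp [act, Matrix.toLpLin_apply]

theorem act_one_coord (M : SL(2, ℝ)) (v : Plane) : act M v 1 = M 1 0 * v 0 + M 1 1 * v 1 := by
  simp [act, Matrix.toLpLin_apply]

theorem plane_ext {u v : Plane} (h0 : u 0 = v 0) (h1 : u 1 = v 1) : u = v := by
  ext i; fin_cases i <;> assumption

theorem act_one (v : Plane) : act 1 v = v := by
  apply plane_ext <;> simp [act_zero_coord, act_one_coord]

theorem act_mul (M N : SL(2, ℝ)) (v : Plane) : act (M * N) v = act M (act N v) := by
  apply plane_ext <;>
    simp [act_zero_coord, act_one_coord, Matrix.mul_apply, Fin.sum_univ_two] <;> ring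

theorem act_inv_act (M : SL(2, ℝ)) (v : Plane) : act M⁻¹ (act M v) = v := by
  rw [← act_mul, inv_mul_cancel, act_one]

theorem act_act_inv (M : SL(2, ℝ)) (v : Plane) : act M (act M⁻¹ v) = v := by
  rw [← act_mul, mul_inv_cancel, act_one]

theorem act_ne_zero (M : SL(2, ℝ)) {v : Plane} (hv : v ≠ 0) : act M v ≠ 0 := by
  intro h
  apply hv
  rw [← act_inv_act M v, h, map_zero]

theorem wedge_act (M : SL(2, ℝ)) (u v : Plane) : wedge (act M u) (act M v) = wedge u v := by
  have h := M.2
  rw [Matrix.det_fin_two] at h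
  simp only [wedge, act_zero_coord, act_one_coord]
  linear_combination (u 0 * v 1 - u 1 * v 0) * h

theorem matrix_norm_toEuclideanLin_le (N : Matrix (Fin 2) (Fin 2) ℝ) (v : Plane) :
    ‖Matrix.toEuclideanLin N v‖ ≤ ‖N‖ * ‖v‖ := by
  rw [Matrix.l2_opNorm_def]
  exact ((Matrix.toEuclideanLin.trans LinearMap.toContinuousLinearMap) N).le_opNorm v

theorem matrix_norm_le {N : Matrix (Fin 2) (Fin 2) ℝ} {K : ℝ} (hK : 0 ≤ K)
    (h : ∀ v : Plane, ‖Matrix.toEuclideanLin N v‖ ≤ K * ‖v‖) : ‖N‖ ≤ K := by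
  rw [Matrix.l2_opNorm_def]
  exact ContinuousLinearMap.opNorm_le_bound _ hK h

theorem norm_act_le (M : SL(2, ℝ)) (v : Plane) : ‖act M v‖ ≤ opNorm M * ‖v‖ :=
  matrix_norm_toEuclideanLin_le _ v

theorem opNorm_le {M : SL(2, ℝ)} {K : ℝ} (hK : 0 ≤ K) (h : ∀ v, ‖act M v‖ ≤ K * ‖v‖) :
    opNorm M ≤ K :=
  matrix_norm_le hK h

theorem opNorm_mul_le (M N : SL(2, ℝ)) : opNorm (M * N) ≤ opNorm M * opNorm N :=
  Matrix.l2_opNorm_mul _ _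

theorem wedge_add_right (u v w : Plane) : wedge u (v + w) = wedge u v + wedge u w := by
  simp [wedge]; ring

theorem wedge_smul_right (u v : Plane) (c : ℝ) : wedge u (c • v) = c * wedge u v := by
  simp [wedge]; ring

theorem wedge_swap (u v : Plane) : wedge u v = -wedge v u := by simp [wedge]; ring

theorem wedge_self (u : Plane) : wedge u u = 0 := by simp [wedge]; ring

theorem dot_sq_add_wedge_sq (u v : Plane) :
    dot u v ^ 2 + wedge u v ^ 2 = ‖u‖ ^ 2 * ‖v‖ ^ 2 := by
  simp only [dot, wedge, norm_sq_plane]; ring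

theorem abs_wedge_le (u v : Plane) : |wedge u v| ≤ ‖u‖ * ‖v‖ := by
  apply abs_le_of_sq_le_sq _ (by positivity)
  nlinarith [dot_sq_add_wedge_sq u v, sq_nonneg (dot u v)]

/-- The Plücker identity. -/
theorem wedge_plucker (p q r v : Plane) :
    wedge p r * wedge v q = wedge p q * wedge v r + wedge q r * wedge v p := by
  simp only [wedge]; ring

/-- Two vectors with vanishing area form, the second nonzero, are proportional. -/
theorem exists_smul_of_wedge_eq_zero {u v : Plane} (hv : v ≠ 0) (h : wedge u v = 0) :
    ∃ c : ℝ, u = c • v := by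
  have hv2 : ‖v‖ ^ 2 ≠ 0 := by simpa using hv
  refine ⟨dot u v / ‖v‖ ^ 2, ?_⟩
  rw [norm_sq_plane] at hv2 ⊢
  simp only [wedge] at h
  apply plane_ext <;> simp only [PiLp.smul_apply, smul_eq_mul, dot] <;> field_simp
  · linear_combination (v 1) * h
  · linear_combination (-v 0) * h

/-- The rotation of angle `θ`. -/
noncomputable def rot (θ : ℝ) : SL(2, ℝ) :=
  ⟨!![Real.cos θ, -Real.sin θ; Real.sin θ, Real.cos θ], by
    rw [Matrix.det_fin_two_of]; nlinarith [Real.sin_sq_add_cos_sq θ]⟩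

theorem coe_rot (θ : ℝ) : (rot θ : Matrix (Fin 2) (Fin 2) ℝ) =
    !![Real.cos θ, -Real.sin θ; Real.sin θ, Real.cos θ] := rfl

theorem act_rot_zero (θ : ℝ) (v : Plane) :
    act (rot θ) v 0 = Real.cos θ * v 0 - Real.sin θ * v 1 := by
  rw [act_zero_coord, coe_rot]; simp; ring

theorem act_rot_one (θ : ℝ) (v : Plane) :
    act (rot θ) v 1 = Real.sin θ * v 0 + Real.cos θ * v 1 := by
  rw [act_one_coord, coe_rot]; simp

theorem norm_act_rot (θ : ℝ) (v : Plane) : ‖act (rot θ) v‖ = ‖v‖ := by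
  rw [← sq_eq_sq₀ (norm_nonneg _) (norm_nonneg _), norm_sq_plane, norm_sq_plane, act_rot_zero,
    act_rot_one]
  linear_combination (v 0 ^ 2 + v 1 ^ 2) * Real.sin_sq_add_cos_sq θ

theorem opNorm_rot_le (θ : ℝ) : opNorm (rot θ) ≤ 1 :=
  opNorm_le zero_le_one fun v => by rw [norm_act_rot, one_mul]

theorem opNorm_rot_mul_le (θ : ℝ) (M : SL(2, ℝ)) : opNorm (rot θ * M) ≤ opNorm M :=
  (opNorm_mul_le _ _).trans
    (mul_le_of_le_one_left (norm_nonneg _) (opNorm_rot_le θ))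

theorem rot_zero : rot 0 = 1 := by
  ext i j; fin_cases i <;> fin_cases j <;> simp [rot]

theorem norm_rot_sub_one_le (θ : ℝ) :
    ‖(rot θ : Matrix (Fin 2) (Fin 2) ℝ) - 1‖ ≤ |θ| := by
  refine matrix_norm_le (abs_nonneg _) fun v => ?_
  apply le_of_sq_le_sq _ (by positivity)
  have h0 : Matrix.toEuclideanLin ((rot θ : Matrix (Fin 2) (Fin 2) ℝ) - 1) v 0
      = (Real.cos θ - 1) * v 0 - Real.sin θ * v 1 := by
    rw [map_sub, LinearMap.sub_apply, PiLp.sub_apply]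
    change act (rot θ) v 0 - _ = _
    rw [act_rot_zero]; simp; ring
  have h1 : Matrix.toEuclideanLin ((rot θ : Matrix (Fin 2) (Fin 2) ℝ) - 1) v 1
      = Real.sin θ * v 0 + (Real.cos θ - 1) * v 1 := by
    rw [map_sub, LinearMap.sub_apply, PiLp.sub_apply]
    change act (rot θ) v 1 - _ = _
    rw [act_rot_one]; simp; ring
  rw [mul_pow, sq_abs, norm_sq_plane, norm_sq_plane, h0, h1]
  have hc := Real.one_sub_sq_div_two_le_cos (x := θ)
  nlinarith [Real.sin_sq_add_cos_sq θ, sq_nonneg (v 0), sq_nonneg (v 1),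
    mul_nonneg (sub_nonneg.2 hc) (add_nonneg (sq_nonneg (v 0)) (sq_nonneg (v 1)))]

theorem continuous_rot : Continuous rot := by
  refine Continuous.subtype_mk ?_ _
  refine continuous_matrix fun i j => ?_
  fin_cases i <;> fin_cases j <;> simp <;> fun_prop

/-- Inversion of `SL(2,ℝ)` is conjugate, by an isometry, to transposition. -/
theorem opNorm_inv (M : SL(2, ℝ)) : opNorm M⁻¹ = opNorm M := by
  have key : ∀ N : SL(2, ℝ), opNorm N⁻¹ ≤ opNorm N := by
    intro N
    obtain ⟨N', hN'⟩ : ∃ N' : SL(2, ℝ), (N' : Matrix (Fin 2) (Fin 2) ℝ) =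
        (N : Matrix (Fin 2) (Fin 2) ℝ).transpose :=
      ⟨⟨(N : Matrix (Fin 2) (Fin 2) ℝ).transpose, (Matrix.det_transpose _).trans N.2⟩, rfl⟩
    have h : N⁻¹ = rot (Real.pi / 2) * (N' * rot (-(Real.pi / 2))) := by
      ext i j
      rw [Matrix.SpecialLinearGroup.coe_inv, Matrix.adjugate_fin_two]
      rw [Matrix.SpecialLinearGroup.coe_mul, Matrix.SpecialLinearGroup.coe_mul, coe_rot, coe_rot,
        hN']
      fin_cases i <;> fin_cases j <;> simp [Matrix.mul_apply, Fin.sum_univ_two]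
    rw [h]
    refine (opNorm_rot_mul_le _ _).trans ((opNorm_mul_le _ _).trans ?_)
    refine (mul_le_of_le_one_right (norm_nonneg _) (opNorm_rot_le _)).trans ?_
    have := Matrix.l2_opNorm_conjTranspose (N : Matrix (Fin 2) (Fin 2) ℝ)
    rw [Matrix.conjTranspose_eq_transpose_of_trivial, ← hN'] at this
    exact this.le
  refine le_antisymm (key M) ?_
  simpa using key M⁻¹

theorem one_le_opNorm (M : SL(2, ℝ)) : 1 ≤ opNorm M := by
  have h := opNorm_mul_le M⁻¹ M
  rw [opNorm_inv, inv_mul_cancel] at h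
  have h1 : opNorm 1 = 1 := by simp [opNorm]
  rw [h1] at h
  nlinarith [norm_nonneg (M : Matrix (Fin 2) (Fin 2) ℝ)]

theorem opNorm_pos (M : SL(2, ℝ)) : 0 < opNorm M := one_pos.trans_le (one_le_opNorm M)

theorem norm_le_opNorm_mul (M : SL(2, ℝ)) (v : Plane) : ‖v‖ ≤ opNorm M * ‖act M v‖ := by
  have h := norm_act_le M⁻¹ (act M v)
  rwa [act_inv_act, opNorm_inv] at h

/-- A matrix of `SL(2,ℝ)` contracts some direction by the inverse of its norm. -/
theorem exists_contracted (M : SL(2, ℝ)) : ∃ s : Plane, ‖s‖ = 1 ∧ ‖act M s‖ ≤ (opNorm M)⁻¹ := by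
  obtain ⟨y, hy, hmax⟩ := (isCompact_sphere (0 : Plane) 1).exists_isMaxOn
    (NormedSpace.sphere_nonempty.2 zero_le_one)
    (f := fun y => ‖act M⁻¹ y‖) (LinearMap.continuous_of_finiteDimensional _).norm.continuousOn
  have hy1 : ‖y‖ = 1 := by simpa using hy
  have hle : opNorm M ≤ ‖act M⁻¹ y‖ := by
    rw [← opNorm_inv]
    refine opNorm_le (norm_nonneg _) fun v => ?_
    rcases eq_or_ne v 0 with rfl | hv
    · simp
    have hv' : ‖v‖ ≠ 0 := norm_ne_zero_iff.2 hv
    have := hmax (a := ‖v‖⁻¹ • v) (by simp [norm_smul, hv'])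
    simp only [Set.mem_ofPred_eq, map_smul, norm_smul, norm_inv, norm_norm] at this
    rwa [inv_mul_le_iff₀ (by positivity), mul_comm] at this
  have hpos := (opNorm_pos M).trans_le hle
  refine ⟨‖act M⁻¹ y‖⁻¹ • act M⁻¹ y, ?_, ?_⟩
  · rw [norm_smul, norm_inv, norm_norm, inv_mul_cancel₀ hpos.ne']
  · rw [map_smul, act_act_inv, norm_smul, norm_inv, norm_norm, hy1, mul_one]
    exact inv_anti₀ (opNorm_pos M) hle

/-- The vector obtained from `v` by a quarter turn. -/
def quarterTurn (v : Plane) : Plane := !₂[-v 1, v 0]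

theorem norm_quarterTurn (v : Plane) : ‖quarterTurn v‖ = ‖v‖ := by
  rw [← sq_eq_sq₀ (norm_nonneg _) (norm_nonneg _), norm_sq_plane, norm_sq_plane]
  simp [quarterTurn]; ring

theorem eq_dot_smul_add_wedge_smul {s : Plane} (hs : ‖s‖ = 1) (v : Plane) :
    v = dot s v • s + wedge s v • quarterTurn s := by
  have h := norm_sq_plane s
  rw [hs] at h
  apply plane_ext <;> simp [quarterTurn, dot, wedge]
  · linear_combination v 0 * h
  · linear_combination v 1 * h

/-! ### Products along a sequence of matrices -/

/-- The product `B (n-1) * ⋯ * B 0`. -/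
def seqProd (B : ℕ → SL(2, ℝ)) : ℕ → SL(2, ℝ)
  | 0 => 1
  | n + 1 => B n * seqProd B n

theorem seqProd_add (B : ℕ → SL(2, ℝ)) (m n : ℕ) :
    seqProd B (m + n) = seqProd (fun i => B (m + i)) n * seqProd B m := by
  induction n with
  | zero => simp [seqProd]
  | succ n ih => rw [← add_assoc, seqProd, ih, seqProd, mul_assoc]

theorem seqProd_congr {B B' : ℕ → SL(2, ℝ)} {n : ℕ} (h : ∀ i < n, B i = B' i) :
    seqProd B n = seqProd B' n := by
  induction n with
  | zero => rfl
  | succ n ih => rw [seqProd, seqProd, h n (by omega), ih fun i hi => h i (by omega)]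

theorem opNorm_seqProd_le {B : ℕ → SL(2, ℝ)} {C : ℝ} {n : ℕ} (h : ∀ i < n, opNorm (B i) ≤ C) :
    opNorm (seqProd B n) ≤ C ^ n := by
  induction n with
  | zero => simp [seqProd, opNorm]
  | succ n ih =>
    rw [seqProd, pow_succ']
    have hC : 0 ≤ C := (norm_nonneg _).trans (h n (by omega))
    exact (opNorm_mul_le _ _).trans
      (mul_le_mul (h n (by omega)) (ih fun i hi => h i (by omega)) (norm_nonneg _) hC)

/-! ### Directions reachable by small rotations -/

/-- The sequence `A` perturbed by rotations of angles `θ`. -/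
noncomputable def rotated (θ : ℕ → ℝ) (A : ℕ → SL(2, ℝ)) (i : ℕ) : SL(2, ℝ) := rot (θ i) * A i

/-- The direction of `v` can be reached from that of `u` in `n` steps, by composing each matrix
`A i` with a rotation of angle at most `δ`. Directions are unoriented: proportionality is expressed
by the vanishing of the area form. -/
def Reach (δ : ℝ) (A : ℕ → SL(2, ℝ)) (n : ℕ) (u v : Plane) : Prop :=
  ∃ θ : ℕ → ℝ, (∀ i, |θ i| ≤ δ) ∧ wedge v (act (seqProd (rotated θ A) n) u) = 0

theorem Reach.succ {δ : ℝ} {A : ℕ → SL(2, ℝ)} {n : ℕ} {u v v' : Plane} (hu : u ≠ 0)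
    (h : Reach δ A n u v') {t : ℝ} (ht : |t| ≤ δ)
    (hv : wedge v (act (rot t) (act (A n) v')) = 0) (hv' : v' ≠ 0) : Reach δ A (n + 1) u v := by
  obtain ⟨θ, hθ, h0⟩ := h
  obtain ⟨c, hc⟩ := exists_smul_of_wedge_eq_zero (act_ne_zero _ hu) h0
  have hc0 : c ≠ 0 := by
    rintro rfl
    exact hv' (by simpa using hc)
  refine ⟨Function.update θ n t, fun i => ?_, ?_⟩
  · rcases eq_or_ne i n with rfl | hi
    · simpa using ht
    · simpa [hi] using hθ i
  · have h1 : seqProd (rotated (Function.update θ n t) A) n = seqProd (rotated θ A) n :=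
      seqProd_congr fun i hi => by simp [rotated, hi.ne]
    rw [seqProd, h1, act_mul, rotated, Function.update_self, act_mul]
    rw [hc, map_smul, map_smul, wedge_smul_right] at hv
    exact (mul_eq_zero.1 hv).resolve_left hc0

theorem reach_all_succ {δ : ℝ} (hδ : 0 ≤ δ) {A : ℕ → SL(2, ℝ)} {n : ℕ} {u : Plane} (hu : u ≠ 0)
    (h : ∀ v ≠ 0, Reach δ A n u v) : ∀ v ≠ 0, Reach δ A (n + 1) u v := fun v hv =>
  (h _ (act_ne_zero (A n)⁻¹ hv)).succ hu (t := 0) (by simpa using hδ)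
    (by rw [rot_zero, act_one, act_act_inv, wedge_self]) (act_ne_zero _ hv)

theorem wedge_rot_rot (s t : ℝ) (u v : Plane) :
    wedge (act (rot s) u) (act (rot t) v)
      = Real.cos (t - s) * wedge u v + Real.sin (t - s) * dot u v := by
  simp only [wedge, dot, act_rot_zero, act_rot_one, Real.cos_sub, Real.sin_sub]
  ring

theorem act_rot_rot (s t : ℝ) (v : Plane) : act (rot s) (act (rot t) v) = act (rot (s + t)) v := by
  apply plane_ext <;> simp only [act_rot_zero, act_rot_one, Real.cos_add, Real.sin_add] <;> ring

theorem dot_self (v : Plane) : dot v v = ‖v‖ ^ 2 := by rw [norm_sq_plane, dot]; ring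

theorem wedge_rot_right (t : ℝ) (v : Plane) : wedge v (act (rot t) v) = Real.sin t * ‖v‖ ^ 2 := by
  have := wedge_rot_rot 0 t v v
  rwa [rot_zero, act_one, sub_zero, wedge_self, dot_self, mul_zero, zero_add] at this

theorem wedge_rot_neg_left (t : ℝ) (v : Plane) :
    wedge (act (rot (-t)) v) v = Real.sin t * ‖v‖ ^ 2 := by
  have := wedge_rot_rot (-t) 0 v v
  rwa [rot_zero, act_one, wedge_self, dot_self, mul_zero, zero_add, zero_sub, neg_neg] at this

theorem mul_pos_of_continuous_of_ne_zero {f : ℝ → ℝ} {c : ℝ} (hc : 0 ≤ c) (hf : Continuous f)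
    (h : ∀ t, 0 ≤ t → t ≤ c → f t ≠ 0) : 0 < f 0 * f c := by
  by_contra! hneg
  have key : (0 : ℝ) ∈ f '' Set.Icc 0 c := by
    rcases mul_nonpos_iff.1 hneg with ⟨h1, h2⟩ | ⟨h1, h2⟩
    · exact intermediate_value_Icc' hc hf.continuousOn ⟨h2, h1⟩
    · exact intermediate_value_Icc hc hf.continuousOn ⟨h1, h2⟩
  obtain ⟨t, ⟨h1, h2⟩, h3⟩ := key
  exact h t h1 h2 h3

theorem continuous_wedge_rot (v w : Plane) : Continuous fun t => wedge v (act (rot t) w) := by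
  simp only [wedge, act_rot_zero, act_rot_one]
  fun_prop

/-- Every direction of the cone spanned by `a` and `b` can be reached from `u` in `n` steps. The
cone is either nondegenerate and positively oriented, or a half-line given by `a = b`, which is the
situation at time `0`. -/
structure ReachCone (δ : ℝ) (A : ℕ → SL(2, ℝ)) (n : ℕ) (u a b : Plane) : Prop where
  left_ne : a ≠ 0
  right_ne : b ≠ 0
  pos_or_eq : 0 < wedge a b ∨ a = b
  reach : ∀ x y : ℝ, 0 ≤ x → 0 ≤ y → x • a + y • b ≠ 0 → Reach δ A n u (x • a + y • b)

/-- A direction that cannot be reached in one more step is never met while rotating `A n a`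
backwards, moving from `A n a` to `A n b`, or rotating `A n b` forwards. -/
theorem ReachCone.mul_pos_of_not_reach {δ : ℝ} (hδ : 0 ≤ δ) {A : ℕ → SL(2, ℝ)}
    {n : ℕ} {u a b : Plane} (hu : u ≠ 0) (h : ReachCone δ A n u a b) {v : Plane}
    (hv : ¬ Reach δ A (n + 1) u v) :
    0 < wedge v (act (A n) a) * wedge v (act (rot (-δ)) (act (A n) a)) ∧
    0 < wedge v (act (A n) a) * wedge v (act (A n) b) ∧
    0 < wedge v (act (A n) b) * wedge v (act (rot δ) (act (A n) b)) := by
  have ha : Reach δ A n u a := by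
    simpa using h.reach 1 0 zero_le_one le_rfl (by simpa using h.left_ne)
  have hb : Reach δ A n u b := by
    simpa using h.reach 0 1 le_rfl zero_le_one (by simpa using h.right_ne)
  refine ⟨?_, ?_, ?_⟩
  · have := mul_pos_of_continuous_of_ne_zero hδ
      ((continuous_wedge_rot v (act (A n) a)).comp continuous_neg) fun t h0 h1 h2 =>
        hv (ha.succ hu (by rwa [abs_neg, abs_of_nonneg h0]) h2 h.left_ne)
    simpa [rot_zero, act_one] using this
  · have := mul_pos_of_continuous_of_ne_zero zero_le_one
      (f := fun s => wedge v (act (A n) ((1 - s) • a + s • b))) ?_ fun s h0 h1 h2 => ?_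
    · simpa using this
    · simp only [map_add, map_smul, wedge_add_right, wedge_smul_right]
      fun_prop
    · have hne : (1 - s) • a + s • b ≠ 0 := by
        rcases h.pos_or_eq with hpos | rfl
        · intro h3
          have e1 : wedge a ((1 - s) • a + s • b) = s * wedge a b := by
            rw [wedge_add_right, wedge_smul_right, wedge_smul_right, wedge_self]; ring
          have e2 : wedge b ((1 - s) • a + s • b) = -((1 - s) * wedge a b) := by
            rw [wedge_add_right, wedge_smul_right, wedge_smul_right, wedge_self, wedge_swap b a]
            ring
          rw [h3] at e1 e2
          have z1 : wedge a 0 = 0 := by simp [wedge]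
          have z2 : wedge b 0 = 0 := by simp [wedge]
          rw [z1] at e1
          rw [z2] at e2
          nlinarith
        · rw [← add_smul]; simpa using h.left_ne
      refine hv ((h.reach (1 - s) s (by linarith) h0 hne).succ hu (t := 0) (by simpa using hδ) ?_
        hne)
      rw [rot_zero, act_one]
      exact h2
  · have := mul_pos_of_continuous_of_ne_zero hδ (continuous_wedge_rot v (act (A n) b))
      fun t h0 h1 h2 => hv (hb.succ hu (by rwa [abs_of_nonneg h0]) h2 h.right_ne)
    simpa [rot_zero, act_one] using this

/-- In one more step, either all directions are reached, or the reached directions contain the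
image of the cone with both sides rotated outwards by `δ`, and this is still a convex cone. -/
theorem ReachCone.step {δ : ℝ} (hδ : 0 < δ) (hδ' : δ < Real.pi) {A : ℕ → SL(2, ℝ)}
    {n : ℕ} {u a b : Plane} (hu : u ≠ 0) (h : ReachCone δ A n u a b) :
    (∀ v ≠ 0, Reach δ A (n + 1) u v) ∨
    0 < wedge (act (rot (-δ)) (act (A n) a)) (act (rot δ) (act (A n) b)) ∧
      ReachCone δ A (n + 1) u (act (rot (-δ)) (act (A n) a)) (act (rot δ) (act (A n) b)) := by
  by_cases hall : ∀ v ≠ 0, Reach δ A (n + 1) u v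
  · exact Or.inl hall
  right
  push Not at hall
  obtain ⟨v, hv0, hv⟩ := hall
  have hsin : 0 < Real.sin δ := Real.sin_pos_of_pos_of_lt_pi hδ hδ'
  set p := act (A n) a with hp
  set q := act (A n) b with hq
  have hp0 : p ≠ 0 := act_ne_zero _ h.left_ne
  have hq0 : q ≠ 0 := act_ne_zero _ h.right_ne
  set P := act (rot (-δ)) p with hP
  set Q := act (rot δ) q with hQ
  have hpq : 0 ≤ wedge p q := by
    rw [hp, hq, wedge_act]
    rcases h.pos_or_eq with h1 | rfl
    · exact h1.le
    · rw [wedge_self]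
  have hPp : 0 < wedge P p := by
    rw [hP, wedge_rot_neg_left]; have := norm_pos_iff.2 hp0; positivity
  have hqQ : 0 < wedge q Q := by
    rw [hQ, wedge_rot_right]; have := norm_pos_iff.2 hq0; positivity
  have hPQ : 0 < wedge P Q := by
    obtain ⟨h1, h2, h3⟩ := h.mul_pos_of_not_reach hδ.le hu hv
    rw [← hp, ← hP] at h1
    rw [← hp, ← hq] at h2
    rw [← hq, ← hQ] at h3
    have hvp : wedge v p ≠ 0 := left_ne_zero_of_mul h2.ne'
    have hvq : wedge v q ≠ 0 := right_ne_zero_of_mul h2.ne'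
    have hPq : 0 < wedge P q := by
      have e : wedge P q * wedge v p ^ 2 = wedge P p * (wedge v p * wedge v q)
          + wedge p q * (wedge v p * wedge v P) := by
        linear_combination (wedge v p) * wedge_plucker P p q v
      have : 0 < wedge P q * wedge v p ^ 2 := by rw [e]; positivity
      exact pos_of_mul_pos_left this (sq_nonneg _)
    have h4 : 0 < wedge v q * wedge v P := by
      have : 0 < (wedge v p * wedge v q) * (wedge v p * wedge v P) := by positivity
      have e : (wedge v p * wedge v q) * (wedge v p * wedge v P)
        = (wedge v q * wedge v P) * wedge v p ^ 2 := by ring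
      rw [e] at this
      exact pos_of_mul_pos_left this (sq_nonneg _)
    have e : wedge P Q * wedge v q ^ 2 = wedge P q * (wedge v q * wedge v Q)
        + wedge q Q * (wedge v q * wedge v P) := by
      linear_combination (wedge v q) * wedge_plucker P q Q v
    have : 0 < wedge P Q * wedge v q ^ 2 := by rw [e]; positivity
    exact pos_of_mul_pos_left this (sq_nonneg _)
  refine ⟨hPQ, act_ne_zero _ hp0, act_ne_zero _ hq0, Or.inl hPQ, fun x y hx hy _ => ?_⟩
  by_contra hnot
  obtain ⟨h1, h2, h3⟩ := h.mul_pos_of_not_reach hδ.le hu hnot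
  rw [← hp, ← hP] at h1
  rw [← hp, ← hq] at h2
  rw [← hq, ← hQ] at h3
  set w := x • P + y • Q with hw
  have e1 : wedge w P = -(y * wedge P Q) := by
    rw [wedge_swap, hw, wedge_add_right, wedge_smul_right, wedge_smul_right, wedge_self]; ring
  have e2 : wedge w Q = x * wedge P Q := by
    rw [wedge_swap, hw, wedge_add_right, wedge_smul_right, wedge_smul_right, wedge_self,
      wedge_swap Q P]; ring
  have hneg : wedge w P * wedge w Q ≤ 0 := by
    rw [e1, e2]
    have : 0 ≤ (y * wedge P Q) * (x * wedge P Q) := by positivity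
    linarith
  have : 0 < (wedge w p * wedge w P) * (wedge w p * wedge w q) * (wedge w q * wedge w Q) := by
    positivity
  have e : (wedge w p * wedge w P) * (wedge w p * wedge w q) * (wedge w q * wedge w Q)
    = (wedge w P * wedge w Q) * (wedge w p * wedge w q) ^ 2 := by ring
  rw [e] at this
  exact absurd (pos_of_mul_pos_left this (sq_nonneg _)) (not_lt.2 hneg)

/-- The orbit of `u` when each matrix is followed by the rotation of angle `δ`. -/
noncomputable def arcEnd (δ : ℝ) (A : ℕ → SL(2, ℝ)) (u : Plane) : ℕ → Plane
  | 0 => u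
  | n + 1 => act (rot δ) (act (A n) (arcEnd δ A u n))

/-- As long as some direction is not reached, the directions reached from `u` contain the arc
between the two extreme orbits, which has length less than a half turn. -/
theorem wedge_arcEnd_pos {δ : ℝ} (hδ : 0 < δ) (hδ' : δ < Real.pi) {A : ℕ → SL(2, ℝ)} {n : ℕ}
    {u w : Plane} (hu : u ≠ 0) (hw : w ≠ 0) (h : ¬ Reach δ A n u w) :
    ∀ i, 1 ≤ i → i ≤ n → 0 < wedge (arcEnd (-δ) A u i) (arcEnd δ A u i) := by
  have key : ∀ n, (∀ v ≠ 0, Reach δ A n u v) ∨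
      ReachCone δ A n u (arcEnd (-δ) A u n) (arcEnd δ A u n) ∧
        ∀ i, 1 ≤ i → i ≤ n → 0 < wedge (arcEnd (-δ) A u i) (arcEnd δ A u i) := by
    intro n
    induction n with
    | zero =>
      refine Or.inr ⟨⟨hu, hu, Or.inr rfl, fun x y hx hy _ => ⟨0, by simpa using hδ.le, ?_⟩⟩,
        fun i h1 h2 => by omega⟩
      simp only [seqProd, act_one, arcEnd]
      rw [wedge_swap, wedge_add_right, wedge_smul_right, wedge_smul_right, wedge_self]; ring
    | succ n ih =>
      rcases ih with h1 | ⟨h1, h2⟩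
      · exact Or.inl (reach_all_succ hδ.le hu h1)
      · rcases h1.step hδ hδ' hu with h3 | ⟨h3, h4⟩
        · exact Or.inl h3
        · refine Or.inr ⟨h4, fun i hi hi' => ?_⟩
          rcases Nat.lt_or_ge n i with hlt | hle
          · obtain rfl : i = n + 1 := by omega
            exact h3
          · exact h2 i hi hle
  rcases key n with h1 | ⟨-, h2⟩
  · exact absurd (h1 w hw) h
  · exact h2

/-! ### The quadratic form of a cone -/

/-- If a cone is the thickening of a cone, and is mapped into a cone even after thickening, then
its angle is bounded away from `0` and `π`. -/
theorem le_wedge_of_thickening {δ : ℝ} (hδ : 0 < δ) (hδ' : δ < Real.pi / 4) {M : SL(2, ℝ)} {C : ℝ}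
    (hM : opNorm M ≤ C) {a b : Plane} (hab : 0 < wedge a b)
    (hpre : 0 ≤ wedge (act (rot δ) a) (act (rot (-δ)) b))
    (hpost : 0 < wedge (act (rot (-δ)) (act M a)) (act (rot δ) (act M b))) :
    Real.sin (2 * δ) / C ^ 2 * (‖a‖ * ‖b‖) ≤ wedge a b := by
  have hC : 1 ≤ C := (one_le_opNorm M).trans hM
  have hs : 0 < Real.sin (2 * δ) := Real.sin_pos_of_pos_of_lt_pi (by linarith) (by linarith)
  have hc : 0 < Real.cos (2 * δ) := Real.cos_pos_of_mem_Ioo ⟨by linarith, by linarith⟩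
  have hs1 := Real.sin_le_one (2 * δ)
  have hsc := Real.sin_sq_add_cos_sq (2 * δ)
  have hMa : ‖a‖ ≤ C * ‖act M a‖ :=
    (norm_le_opNorm_mul M a).trans (mul_le_mul_of_nonneg_right hM (norm_nonneg _))
  have hMb : ‖b‖ ≤ C * ‖act M b‖ :=
    (norm_le_opNorm_mul M b).trans (mul_le_mul_of_nonneg_right hM (norm_nonneg _))
  -- if the angle of `p` and `q` is at least `2δ` and at most `π - 2δ`
  have key : ∀ p q : Plane, 0 < wedge p q →
      Real.sin (2 * δ) * |dot p q| ≤ Real.cos (2 * δ) * wedge p q →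
      Real.sin (2 * δ) * (‖p‖ * ‖q‖) ≤ wedge p q := by
    intro p q h0 h
    apply le_of_sq_le_sq _ h0.le
    have h1 : (Real.sin (2 * δ) * |dot p q|) ^ 2 ≤ (Real.cos (2 * δ) * wedge p q) ^ 2 := by
      gcongr
    rw [mul_pow, sq_abs, mul_pow] at h1
    have e : (Real.sin (2 * δ) * (‖p‖ * ‖q‖)) ^ 2
        = Real.sin (2 * δ) ^ 2 * dot p q ^ 2 + Real.sin (2 * δ) ^ 2 * wedge p q ^ 2 := by
      linear_combination (-Real.sin (2 * δ) ^ 2) * dot_sq_add_wedge_sq p q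
    rw [e]
    nlinarith
  rw [div_mul_eq_mul_div, div_le_iff₀ (by positivity)]
  have hC2 : 1 ≤ C ^ 2 := one_le_pow₀ hC
  rcases le_or_gt 0 (dot a b) with hd | hd
  · rw [wedge_rot_rot, show -δ - δ = -(2 * δ) by ring, Real.cos_neg, Real.sin_neg] at hpre
    have := key a b hab (by rw [abs_of_nonneg hd]; linarith)
    nlinarith
  rcases le_or_gt 0 (dot (act M a) (act M b)) with hd' | hd'
  · -- otherwise `a` and `b` are nearly opposite, and so would be `M a` and `M b`
    set α := ‖a‖
    set β := ‖b‖
    have hα : 0 ≤ α := norm_nonneg a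
    have hβ : 0 ≤ β := norm_nonneg b
    have hn : ‖act M (β • a + α • b)‖ ^ 2 = β ^ 2 * ‖act M a‖ ^ 2 + α ^ 2 * ‖act M b‖ ^ 2
        + 2 * (α * β) * dot (act M a) (act M b) := by
      simp only [map_add, map_smul, norm_sq_plane, dot, PiLp.add_apply, PiLp.smul_apply,
        smul_eq_mul]
      ring
    have hn' : ‖β • a + α • b‖ ^ 2 = 2 * (α * β) ^ 2 + 2 * (α * β) * dot a b := by
      have ea : α ^ 2 = _ := norm_sq_plane a
      have eb : β ^ 2 = _ := norm_sq_plane b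
      simp only [norm_sq_plane, dot, PiLp.add_apply, PiLp.smul_apply, smul_eq_mul]
      linear_combination (-β ^ 2) * ea - α ^ 2 * eb
    have h1 : ‖act M (β • a + α • b)‖ ^ 2 ≤ C ^ 2 * ‖β • a + α • b‖ ^ 2 := by
      rw [← mul_pow]
      gcongr
      exact (norm_act_le M _).trans (mul_le_mul_of_nonneg_right hM (norm_nonneg _))
    have ha2 : α ^ 2 ≤ C ^ 2 * ‖act M a‖ ^ 2 := by rw [← mul_pow]; gcongr
    have hb2 : β ^ 2 ≤ C ^ 2 * ‖act M b‖ ^ 2 := by rw [← mul_pow]; gcongr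
    have hαβ : 0 < α * β := hab.trans_le ((le_abs_self _).trans (abs_wedge_le a b))
    -- `dot a b ≥ -αβ (1 - C⁻⁴)`
    have h2 : α * β ≤ C ^ 4 * (α * β + dot a b) := by
      have h3 : 2 * (α * β) ^ 2 ≤ C ^ 2 * ‖act M (β • a + α • b)‖ ^ 2 := by
        rw [hn]
        have t1 := mul_le_mul_of_nonneg_left ha2 (sq_nonneg β)
        have t2 := mul_le_mul_of_nonneg_left hb2 (sq_nonneg α)
        have t3 : 0 ≤ C ^ 2 * (2 * (α * β) * dot (act M a) (act M b)) := by positivity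
        nlinarith
      have h4 : 2 * (α * β) ^ 2 ≤ C ^ 2 * (C ^ 2 * (2 * (α * β) ^ 2 + 2 * (α * β) * dot a b)) := by
        rw [← hn']
        exact h3.trans (mul_le_mul_of_nonneg_left h1 (by positivity))
      have h5 : (2 * (α * β)) * (α * β) ≤ (2 * (α * β)) * (C ^ 4 * (α * β + dot a b)) := by
        nlinarith
      exact le_of_mul_le_mul_left h5 (by positivity)
    have h6 : (α * β) ^ 2 ≤ (wedge a b * C ^ 2) ^ 2 := by
      have e : (wedge a b * C ^ 2) ^ 2 = C ^ 4 * (α * β + dot a b) * (α * β - dot a b) := by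
        linear_combination C ^ 4 * dot_sq_add_wedge_sq a b
      rw [e, sq]
      exact mul_le_mul h2 (by linarith) hαβ.le (by nlinarith [sq_nonneg (C ^ 2)])
    have h7 : α * β ≤ wedge a b * C ^ 2 := le_of_sq_le_sq h6 (by positivity)
    nlinarith
  · rw [wedge_rot_rot, show δ - -δ = 2 * δ by ring] at hpost
    have h1 := key (act M a) (act M b) (by rwa [wedge_act])
      (by rw [abs_of_neg hd']; linarith)
    rw [wedge_act] at h1
    have h2 : ‖a‖ * ‖b‖ ≤ C ^ 2 * (‖act M a‖ * ‖act M b‖) := by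
      calc ‖a‖ * ‖b‖ ≤ (C * ‖act M a‖) * (C * ‖act M b‖) := by gcongr
        _ = _ := by ring
    nlinarith

/-- The quadratic form that vanishes on the sides of the cone spanned by `a` and `b` and is
positive inside. -/
noncomputable def coneForm (a b v : Plane) : ℝ := wedge a v * wedge v b / wedge a b

theorem coneForm_act (M : SL(2, ℝ)) (a b v : Plane) :
    coneForm (act M a) (act M b) (act M v) = coneForm a b v := by
  simp only [coneForm, wedge_act]

theorem abs_coneForm_le {a b : Plane} {κ : ℝ} (hκ : 0 < κ) (hab : 0 < wedge a b)
    (h : κ * (‖a‖ * ‖b‖) ≤ wedge a b) (v : Plane) : |coneForm a b v| ≤ κ⁻¹ * ‖v‖ ^ 2 := by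
  rw [coneForm, abs_div, abs_mul, abs_of_pos hab, div_le_iff₀ hab]
  calc |wedge a v| * |wedge v b| ≤ (‖a‖ * ‖v‖) * (‖v‖ * ‖b‖) := by
        gcongr <;> apply abs_wedge_le
    _ = κ⁻¹ * ‖v‖ ^ 2 * (κ * (‖a‖ * ‖b‖)) := by field_simp
    _ ≤ _ := by gcongr

/-- Thickening a cone increases its quadratic form by a definite amount. -/
theorem coneForm_thickening {δ : ℝ} (hδ : 0 < δ) (hδ' : δ < Real.pi / 4) {κ : ℝ} (hκ : 0 < κ)
    {p q : Plane} (hpq : 0 < wedge p q)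
    (hPQ : 0 < wedge (act (rot (-δ)) p) (act (rot δ) q))
    (h : κ * (‖act (rot (-δ)) p‖ * ‖act (rot δ) q‖) ≤ wedge (act (rot (-δ)) p) (act (rot δ) q))
    (v : Plane) :
    Real.sin δ * κ ^ 2 / 8 * ‖v‖ ^ 2
      ≤ coneForm (act (rot (-δ)) p) (act (rot δ) q) v - coneForm p q v := by
  have hs : 0 < Real.sin δ := Real.sin_pos_of_pos_of_lt_pi (by linarith) (by linarith)
  have hc : 0 < Real.cos δ := Real.cos_pos_of_mem_Ioo ⟨by linarith, by linarith⟩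
  have hpQ' : 2 * Real.cos δ * wedge p (act (rot δ) q)
      = wedge (act (rot (-δ)) p) (act (rot δ) q) + wedge p q := by
    have e := wedge_rot_rot 0 δ p q
    rw [rot_zero, act_one, sub_zero] at e
    rw [e, wedge_rot_rot, show δ - -δ = 2 * δ by ring, Real.cos_two_mul, Real.sin_two_mul]
    ring
  have hPp := wedge_rot_neg_left δ p
  have hqQ := wedge_rot_right δ q
  have nP := norm_act_rot (-δ) p
  have nQ := norm_act_rot δ q
  set P := act (rot (-δ)) p
  set Q := act (rot δ) q
  have hpQ : 0 < wedge p Q := by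
    have : 0 < 2 * Real.cos δ * wedge p Q := by rw [hpQ']; positivity
    exact pos_of_mul_pos_right this (by positivity)
  have hpQκ : κ / 2 * (‖p‖ * ‖Q‖) ≤ wedge p Q := by
    rw [nP] at h
    nlinarith [Real.cos_le_one δ]
  have hp : 0 < ‖p‖ := norm_pos_iff.2 (by rintro rfl; simp [wedge] at hpq)
  have hQ : 0 < ‖Q‖ := norm_pos_iff.2 (by rintro h0; simp [wedge, h0] at hpQ)
  have e1 : coneForm P Q v - coneForm p Q v
      = wedge P p * wedge v Q ^ 2 / (wedge P Q * wedge p Q) := by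
    rw [coneForm, coneForm]
    field_simp
    simp only [wedge]; ring
  have e2 : coneForm p Q v - coneForm p q v
      = wedge q Q * wedge p v ^ 2 / (wedge p Q * wedge p q) := by
    rw [coneForm, coneForm]
    field_simp
    simp only [wedge]; ring
  have i1 : Real.sin δ * (|wedge v Q| / ‖Q‖) ^ 2 ≤ coneForm P Q v - coneForm p Q v := by
    rw [e1, hPp, div_pow, sq_abs, mul_div_assoc', div_le_div_iff₀ (by positivity) (by positivity)]
    have t : wedge P Q * wedge p Q ≤ (‖p‖ * ‖Q‖) * (‖p‖ * ‖Q‖) := by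
      have t1 := (le_abs_self _).trans (abs_wedge_le P Q)
      have t2 := (le_abs_self _).trans (abs_wedge_le p Q)
      rw [nP] at t1
      gcongr
    calc Real.sin δ * wedge v Q ^ 2 * (wedge P Q * wedge p Q)
        ≤ Real.sin δ * wedge v Q ^ 2 * ((‖p‖ * ‖Q‖) * (‖p‖ * ‖Q‖)) := by gcongr
      _ = _ := by ring
  have i2 : Real.sin δ * (|wedge p v| / ‖p‖) ^ 2 ≤ coneForm p Q v - coneForm p q v := by
    rw [e2, hqQ, div_pow, sq_abs, mul_div_assoc', div_le_div_iff₀ (by positivity) (by positivity)]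
    have t : wedge p Q * wedge p q ≤ (‖p‖ * ‖q‖) * (‖p‖ * ‖q‖) := by
      have t1 := (le_abs_self _).trans (abs_wedge_le p Q)
      have t2 := (le_abs_self _).trans (abs_wedge_le p q)
      rw [nQ] at t1
      gcongr
    calc Real.sin δ * wedge p v ^ 2 * (wedge p Q * wedge p q)
        ≤ Real.sin δ * wedge p v ^ 2 * ((‖p‖ * ‖q‖) * (‖p‖ * ‖q‖)) := by gcongr
      _ = _ := by ring
  have i3 : κ / 2 * ‖v‖ ≤ |wedge v Q| / ‖Q‖ + |wedge p v| / ‖p‖ := by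
    have e : wedge p Q • v = wedge v Q • p + wedge p v • Q := by
      apply plane_ext <;> simp only [wedge, PiLp.add_apply, PiLp.smul_apply, smul_eq_mul] <;> ring
    have t := norm_add_le (wedge v Q • p) (wedge p v • Q)
    rw [← e, norm_smul, norm_smul, norm_smul, Real.norm_eq_abs, Real.norm_eq_abs,
      Real.norm_eq_abs, abs_of_pos hpQ] at t
    rw [div_add_div _ _ hQ.ne' hp.ne', le_div_iff₀ (by positivity)]
    calc κ / 2 * ‖v‖ * (‖Q‖ * ‖p‖) = κ / 2 * (‖p‖ * ‖Q‖) * ‖v‖ := by ring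
      _ ≤ wedge p Q * ‖v‖ := by gcongr
      _ ≤ _ := by linarith
  have i4 : κ ^ 2 / 8 * ‖v‖ ^ 2 ≤ (|wedge v Q| / ‖Q‖) ^ 2 + (|wedge p v| / ‖p‖) ^ 2 := by
    have : (κ / 2 * ‖v‖) ^ 2 ≤ (|wedge v Q| / ‖Q‖ + |wedge p v| / ‖p‖) ^ 2 := by gcongr
    nlinarith [sq_nonneg (|wedge v Q| / ‖Q‖ - |wedge p v| / ‖p‖)]
  have i5 := mul_le_mul_of_nonneg_left i4 hs.le
  linarith

/-- Either every direction can be sent to every direction by small rotations, or every orbit is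
controlled by its two ends. -/
theorem sum_norm_sq_le_of_not_reach {δ : ℝ} (hδ : 0 < δ) (hδ' : δ < Real.pi / 4) (C : ℝ) :
    ∃ K : ℝ, 0 < K ∧ ∀ (A : ℕ → SL(2, ℝ)) (k : ℕ), (∀ i, opNorm (A i) ≤ C) →
      ∀ u w : Plane, u ≠ 0 → w ≠ 0 → ¬ Reach δ A (k + 2) u w → ∀ v : Plane,
        ∑ i ∈ Finset.range k, ‖act (seqProd (fun j => A (1 + j)) i) v‖ ^ 2
          ≤ K * (‖v‖ ^ 2 + ‖act (seqProd (fun j => A (1 + j)) k) v‖ ^ 2) := by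
  rcases lt_or_ge C 1 with hC | hC
  · exact ⟨1, one_pos, fun A k hA => absurd ((one_le_opNorm _).trans (hA 0)) (not_le.2 hC)⟩
  have hs : 0 < Real.sin δ := Real.sin_pos_of_pos_of_lt_pi (by linarith) (by linarith)
  have hs2 : 0 < Real.sin (2 * δ) := Real.sin_pos_of_pos_of_lt_pi (by linarith) (by linarith)
  obtain ⟨κ, hκ⟩ : ∃ κ, κ = Real.sin (2 * δ) / C ^ 2 := ⟨_, rfl⟩
  have hκ0 : 0 < κ := by rw [hκ]; positivity
  obtain ⟨η, hη⟩ : ∃ η, η = Real.sin δ * κ ^ 2 / 8 := ⟨_, rfl⟩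
  have hη0 : 0 < η := by rw [hη]; positivity
  refine ⟨η⁻¹ * κ⁻¹ + 1, by positivity, fun A k hA u w hu hw hR v => ?_⟩
  have hpos := wedge_arcEnd_pos hδ (by linarith [Real.pi_pos]) hu hw hR
  set a := arcEnd (-δ) A u
  set b := arcEnd δ A u
  have ha : ∀ i, a (i + 1) = act (rot (-δ)) (act (A i) (a i)) := fun i => rfl
  have hb : ∀ i, b (i + 1) = act (rot δ) (act (A i) (b i)) := fun i => rfl
  have hnonneg : ∀ i, i ≤ k + 2 → 0 ≤ wedge (a i) (b i) := by
    intro i hi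
    rcases Nat.eq_zero_or_pos i with rfl | h0
    · exact (wedge_self u).ge
    · exact (hpos i h0 hi).le
  have hsine : ∀ i, i ≤ k → κ * (‖a (i + 1)‖ * ‖b (i + 1)‖) ≤ wedge (a (i + 1)) (b (i + 1)) := by
    intro i hi
    rw [hκ]
    refine le_wedge_of_thickening hδ hδ' (hA (i + 1)) (hpos _ (by omega) (by omega)) ?_ ?_
    · rw [ha, hb, act_rot_rot, act_rot_rot, neg_add_cancel, add_neg_cancel, rot_zero, act_one,
        act_one, wedge_act]
      exact hnonneg i (by omega)
    · rw [← ha, ← hb]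
      exact hpos _ (by omega) (by omega)
  set x := fun i => act (seqProd (fun j => A (1 + j)) i) v with hx
  have hx1 : ∀ i, x (i + 1) = act (A (i + 1)) (x i) := fun i => by
    simp only [hx, seqProd]; rw [act_mul, add_comm]
  have hstep : ∀ i, i < k → η * ‖x (i + 1)‖ ^ 2 ≤
      coneForm (a (i + 2)) (b (i + 2)) (x (i + 1)) - coneForm (a (i + 1)) (b (i + 1)) (x i) := by
    intro i hi
    rw [hx1, ← coneForm_act (A (i + 1)) (a (i + 1)), ← hx1, hη]
    refine coneForm_thickening hδ hδ' hκ0 ?_ (hpos (i + 2) (by omega) (by omega))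
      (hsine (i + 1) (by omega)) _
    rw [wedge_act]
    exact hpos _ (by omega) (by omega)
  have hsum : η * ∑ i ∈ Finset.range k, ‖x (i + 1)‖ ^ 2 ≤
      coneForm (a (k + 1)) (b (k + 1)) (x k) - coneForm (a 1) (b 1) (x 0) := by
    rw [Finset.mul_sum, ← Finset.sum_range_sub (fun i => coneForm (a (i + 1)) (b (i + 1)) (x i))]
    exact Finset.sum_le_sum fun i hi => hstep i (Finset.mem_range.1 hi)
  have hk := abs_coneForm_le hκ0 (hpos (k + 1) (by omega) (by omega)) (hsine k le_rfl) (x k)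
  have h0 := abs_coneForm_le hκ0 (hpos 1 le_rfl (by omega)) (hsine 0 (Nat.zero_le _)) (x 0)
  have hx0 : x 0 = v := by simp only [hx, seqProd]; rw [act_one]
  have hshift : ∑ i ∈ Finset.range k, ‖x i‖ ^ 2
      ≤ ∑ i ∈ Finset.range k, ‖x (i + 1)‖ ^ 2 + ‖v‖ ^ 2 := by
    have h1 := Finset.sum_range_succ (fun i => ‖x i‖ ^ 2) k
    have h2 := Finset.sum_range_succ' (fun i => ‖x i‖ ^ 2) k
    rw [h1, hx0] at h2
    nlinarith [sq_nonneg ‖x k‖]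
  have hbound : ∑ i ∈ Finset.range k, ‖x (i + 1)‖ ^ 2
      ≤ η⁻¹ * κ⁻¹ * (‖v‖ ^ 2 + ‖x k‖ ^ 2) := by
    rw [mul_assoc, le_inv_mul_iff₀ hη0]
    rw [hx0] at h0 hsum
    have := le_abs_self (coneForm (a (k + 1)) (b (k + 1)) (x k))
    have := neg_abs_le (coneForm (a 1) (b 1) v)
    linarith
  change ∑ i ∈ Finset.range k, ‖x i‖ ^ 2 ≤ _ * (_ + ‖x k‖ ^ 2)
  nlinarith [sq_nonneg ‖x k‖]

/-! ### Lowering the norm of a long product -/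

theorem opNorm_mul_mul_le_of_wedge_eq_zero (P Q : SL(2, ℝ)) :
    ∃ u w : Plane, u ≠ 0 ∧ w ≠ 0 ∧ ∀ M : SL(2, ℝ), wedge w (act M u) = 0 →
      opNorm (Q * (M * P)) ≤ opNorm M * (opNorm P / opNorm Q + opNorm Q / opNorm P) := by
  obtain ⟨s, hs, hPs⟩ := exists_contracted P
  obtain ⟨w, hw, hQw⟩ := exists_contracted Q
  have hP := opNorm_pos P
  have hQ := opNorm_pos Q
  have hw0 : w ≠ 0 := by rintro rfl; simp at hw
  have he : ‖quarterTurn s‖ = 1 := by rw [norm_quarterTurn, hs]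
  have he0 : quarterTurn s ≠ 0 := by intro h; simp [h] at he
  refine ⟨act P (quarterTurn s), w, act_ne_zero _ he0, hw0, fun M hM => ?_⟩
  have hMpos := opNorm_pos M
  obtain ⟨c, hc⟩ := exists_smul_of_wedge_eq_zero hw0 (by rw [wedge_swap, hM, neg_zero])
  have h1 : ‖act (Q * (M * P)) (quarterTurn s)‖ ≤ opNorm M * (opNorm P / opNorm Q) := by
    rw [act_mul, act_mul, hc, map_smul, norm_smul]
    have : ‖c‖ ≤ opNorm M * opNorm P := by
      calc ‖c‖ = ‖act M (act P (quarterTurn s))‖ := by rw [hc, norm_smul, hw, mul_one]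
        _ ≤ opNorm M * (opNorm P * ‖quarterTurn s‖) :=
          (norm_act_le _ _).trans (mul_le_mul_of_nonneg_left (norm_act_le _ _) (norm_nonneg _))
        _ = _ := by rw [he, mul_one]
    calc ‖c‖ * ‖act Q w‖ ≤ (opNorm M * opNorm P) * (opNorm Q)⁻¹ := by gcongr
      _ = _ := by rw [div_eq_mul_inv, mul_assoc]
  have h2 : ‖act (Q * (M * P)) s‖ ≤ opNorm M * (opNorm Q / opNorm P) := by
    rw [act_mul, act_mul]
    calc ‖act Q (act M (act P s))‖ ≤ opNorm Q * (opNorm M * ‖act P s‖) :=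
          (norm_act_le _ _).trans (mul_le_mul_of_nonneg_left (norm_act_le _ _) (norm_nonneg _))
      _ ≤ opNorm Q * (opNorm M * (opNorm P)⁻¹) := by gcongr
      _ = _ := by rw [div_eq_mul_inv]; ring
  refine opNorm_le (by positivity) fun v => ?_
  have hd : |dot s v| ≤ ‖v‖ := by
    apply abs_le_of_sq_le_sq _ (norm_nonneg _)
    have := dot_sq_add_wedge_sq s v
    rw [hs] at this
    nlinarith [sq_nonneg (wedge s v)]
  have hwe : |wedge s v| ≤ ‖v‖ := by simpa [hs] using abs_wedge_le s v
  conv_lhs => rw [eq_dot_smul_add_wedge_smul hs v]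
  rw [map_add, map_smul, map_smul]
  refine (norm_add_le _ _).trans ?_
  rw [norm_smul, norm_smul, Real.norm_eq_abs, Real.norm_eq_abs]
  calc _ ≤ ‖v‖ * (opNorm M * (opNorm Q / opNorm P)) + ‖v‖ * (opNorm M * (opNorm P / opNorm Q)) := by
        gcongr
    _ = _ := by ring

theorem log_opNorm_nonneg (M : SL(2, ℝ)) : 0 ≤ Real.log (opNorm M) :=
  Real.log_nonneg (one_le_opNorm M)

theorem log_opNorm_mul_le (M N : SL(2, ℝ)) :
    Real.log (opNorm (M * N)) ≤ Real.log (opNorm M) + Real.log (opNorm N) := by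
  rw [← Real.log_mul (opNorm_pos M).ne' (opNorm_pos N).ne']
  exact Real.log_le_log (opNorm_pos _) (opNorm_mul_le M N)

theorem abs_log_opNorm_mul_left_sub_le (M N : SL(2, ℝ)) :
    |Real.log (opNorm (M * N)) - Real.log (opNorm N)| ≤ Real.log (opNorm M) := by
  have h1 := log_opNorm_mul_le M N
  have h2 := log_opNorm_mul_le M⁻¹ (M * N)
  rw [inv_mul_cancel_left, opNorm_inv] at h2
  rw [abs_le]; constructor <;> linarith

theorem abs_log_opNorm_mul_right_sub_le (M N : SL(2, ℝ)) :
    |Real.log (opNorm (N * M)) - Real.log (opNorm N)| ≤ Real.log (opNorm M) := by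
  have h1 := log_opNorm_mul_le N M
  have h2 := log_opNorm_mul_le (N * M) M⁻¹
  rw [mul_inv_cancel_right, opNorm_inv] at h2
  rw [abs_le]; constructor <;> linarith

/-- A discrete intermediate value property: a sequence with small increments that changes sign is
small somewhere on any syndetic set. -/
theorem exists_abs_le_of_sign_change {g : ℕ → ℝ} {m L : ℕ} {c : ℝ} (h0 : g 0 ≤ 0) (hm : 0 ≤ g m)
    (hg : ∀ i < m, |g (i + 1) - g i| ≤ c) (hL : 2 * L ≤ m) {S : ℕ → Prop}
    (hS : ∀ j, j + L ≤ m → ∃ i, j ≤ i ∧ i < j + L ∧ S i) :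
    ∃ i < m, S i ∧ |g i| ≤ c * (L + 1) := by
  classical
  have hL0 : 0 < L := by
    obtain ⟨i, h1, h2, -⟩ := hS 0 (by omega)
    omega
  have hc : 0 ≤ c := (abs_nonneg _).trans (hg 0 (by omega))
  have hlip : ∀ d j, j + d ≤ m → |g (j + d) - g j| ≤ c * d := by
    intro d
    induction d with
    | zero => intro j _; simp
    | succ d ih =>
      intro j hj
      have h1 := abs_le.1 (ih j (by omega))
      have h2 := abs_le.1 (hg (j + d) (by omega))
      rw [abs_le, ← add_assoc]
      push_cast
      constructor <;> linarith
  have hex : ∃ i, 0 ≤ g i := ⟨m, hm⟩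
  set j := Nat.find hex with hj
  have hjm : j ≤ m := Nat.find_min' hex hm
  have hgj : 0 ≤ g j := Nat.find_spec hex
  have hgj' : |g j| ≤ c := by
    rw [abs_of_nonneg hgj]
    rcases Nat.eq_zero_or_pos j with h | h
    · rw [h]; exact h0.trans hc
    · have h1 : g (j - 1) < 0 := not_le.1 (Nat.find_min hex (by omega))
      have h2 := (abs_le.1 (hg (j - 1) (by omega))).2
      rw [Nat.sub_add_cancel h] at h2
      linarith
  by_cases hcase : j + L ≤ m
  · obtain ⟨i, h1, h2, h3⟩ := hS j hcase
    refine ⟨i, by omega, h3, ?_⟩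
    have h4 := hlip (i - j) j (by omega)
    rw [Nat.add_sub_cancel' h1] at h4
    have h5 : ((i - j : ℕ) : ℝ) ≤ L := by exact_mod_cast (by omega : i - j ≤ L)
    have h6 := mul_le_mul_of_nonneg_left h5 hc
    have h7 := abs_sub_abs_le_abs_sub (g i) (g j)
    linarith
  · obtain ⟨i, h1, h2, h3⟩ := hS (j - L) (by omega)
    refine ⟨i, by omega, h3, ?_⟩
    have h4 := hlip (j - i) i (by omega)
    rw [Nat.add_sub_cancel' (by omega)] at h4
    have h5 : ((j - i : ℕ) : ℝ) ≤ L := by exact_mod_cast (by omega : j - i ≤ L)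
    have h6 := mul_le_mul_of_nonneg_left h5 hc
    have h7 := abs_sub_abs_le_abs_sub (g i) (g j)
    rw [abs_sub_comm] at h4
    linarith

/-- If positions from which all directions can be reached in `n` steps are frequent, then small
rotations bring down the norm of the product: at a balanced such position, the image of the
direction most expanded before it is sent to the direction most contracted after it. -/
theorem exists_rotated_opNorm_le {δ : ℝ} (hδ : 0 ≤ δ) {A : ℕ → SL(2, ℝ)} {C : ℝ}
    (hA : ∀ i, opNorm (A i) ≤ C) {n m L : ℕ} (hL : 2 * L ≤ m)
    (hS : ∀ j, j + L ≤ m → ∃ i, j ≤ i ∧ i < j + L ∧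
      ∀ u w : Plane, u ≠ 0 → w ≠ 0 → Reach δ (fun k => A (i + k)) n u w) :
    ∃ θ : ℕ → ℝ, (∀ i, |θ i| ≤ δ) ∧
      opNorm (seqProd (rotated θ A) (n + m)) ≤ 2 * C ^ (n + 2 * (L + 1)) := by
  have hC : 1 ≤ C := (one_le_opNorm _).trans (hA 0)
  have hC0 : 0 < C := by linarith
  set P := fun i => seqProd A i with hP
  set Q := fun i => seqProd (fun k => A (i + n + k)) (m - i) with hQ
  have hlog : ∀ i, Real.log (opNorm (A i)) ≤ Real.log C := fun i =>
    Real.log_le_log (opNorm_pos _) (hA i)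
  obtain ⟨i, him, hi, hgi⟩ := exists_abs_le_of_sign_change
    (g := fun i => Real.log (opNorm (P i)) - Real.log (opNorm (Q i))) (c := 2 * Real.log C)
    (m := m) (by simpa [hP, seqProd, opNorm] using log_opNorm_nonneg _)
    (by simpa [hQ, seqProd, opNorm] using log_opNorm_nonneg _) (fun i hi => by
      have h1 := (abs_log_opNorm_mul_left_sub_le (A i) (P i)).trans (hlog i)
      have h2 := (abs_log_opNorm_mul_right_sub_le (A (i + n)) (Q (i + 1))).trans (hlog _)
      have e : Q i = Q (i + 1) * A (i + n) := by
        simp only [hQ]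
        rw [show m - i = 1 + (m - (i + 1)) by omega, seqProd_add]
        simp [seqProd, add_assoc, add_left_comm, add_comm]
      have e' : P (i + 1) = A i * P i := rfl
      rw [← e, abs_le] at h2
      rw [← e', abs_le] at h1
      rw [abs_le]; constructor <;> linarith) hL hS
  obtain ⟨u, w, hu, hw, hM⟩ := opNorm_mul_mul_le_of_wedge_eq_zero (P i) (Q i)
  obtain ⟨θ, hθ, hθw⟩ := hi u w hu hw
  have hle := hM _ hθw
  refine ⟨fun j => if i ≤ j ∧ j < i + n then θ (j - i) else 0, fun j => ?_, ?_⟩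
  · dsimp only
    split_ifs
    · exact hθ _
    · simpa using hδ
  have hprod : seqProd (rotated (fun j => if i ≤ j ∧ j < i + n then θ (j - i) else 0) A) (n + m)
      = Q i * (seqProd (rotated θ fun k => A (i + k)) n * P i) := by
    rw [show n + m = i + (n + (m - i)) by omega, seqProd_add, seqProd_add, mul_assoc]
    congr 1
    · refine seqProd_congr fun j hj => ?_
      simp [rotated, rot_zero, add_assoc]
    congr 1
    · refine seqProd_congr fun j hj => ?_
      simp [rotated, hj]
    · refine seqProd_congr fun j hj => ?_
      simp [rotated, rot_zero, hj.not_ge]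
  rw [hprod]
  have hm : opNorm (seqProd (rotated θ fun k => A (i + k)) n) ≤ C ^ n :=
    opNorm_seqProd_le fun j _ => (opNorm_rot_mul_le _ _).trans (hA _)
  have hratio : ∀ x y : ℝ, 0 < x → 0 < y → Real.log x - Real.log y ≤ 2 * Real.log C * (L + 1) →
      x / y ≤ C ^ (2 * (L + 1)) := by
    intro x y hx hy h
    rw [← Real.log_div hx.ne' hy.ne'] at h
    rw [← Real.log_le_log_iff (by positivity) (by positivity), Real.log_pow]
    push_cast
    linarith
  rw [abs_le] at hgi
  have hP0 := opNorm_pos (P i)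
  have hQ0 := opNorm_pos (Q i)
  have r1 := hratio _ _ hP0 hQ0 hgi.2
  have r2 := hratio _ _ hQ0 hP0 (by linarith [hgi.1])
  calc _ ≤ _ := hle
    _ ≤ C ^ n * (C ^ (2 * (L + 1)) + C ^ (2 * (L + 1))) := by gcongr
    _ = _ := by rw [pow_add]; ring

/-! ### Orbits controlled by their ends are hyperbolic -/

/-- Every finite orbit segment of the sequence `B`, started at time `0`, is controlled by its two
ends. -/
def EndControl (K : ℝ) (B : ℕ → SL(2, ℝ)) : Prop :=
  ∀ (n : ℕ) (v : Plane), ∑ i ∈ Finset.range n, ‖act (seqProd B i) v‖ ^ 2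
    ≤ K * (‖v‖ ^ 2 + ‖act (seqProd B n) v‖ ^ 2)

/-- The vectors whose orbit under the sequence `B` tends to zero. -/
def stableSpace (B : ℕ → SL(2, ℝ)) : Submodule ℝ Plane where
  carrier := {v | Tendsto (fun n => act (seqProd B n) v) atTop (𝓝 0)}
  zero_mem' := by simp
  add_mem' {u v} hu hv := by
    have := Tendsto.add hu hv
    simpa using this
  smul_mem' c v hv := by
    have := Tendsto.const_smul hv c
    simpa using this

theorem mem_stableSpace {B : ℕ → SL(2, ℝ)} {v : Plane} :
    v ∈ stableSpace B ↔ Tendsto (fun n => act (seqProd B n) v) atTop (𝓝 0) := Iff.rfl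

theorem continuous_act (M : SL(2, ℝ)) : Continuous (act M) :=
  LinearMap.continuous_of_finiteDimensional _

/-- A limit of the unit vectors most contracted in `n` steps has a square summable orbit. -/
theorem exists_mem_stableSpace {K : ℝ} {B : ℕ → SL(2, ℝ)} (h : EndControl K B) :
    ∃ s ∈ stableSpace B, ‖s‖ = 1 := by
  have hex : ∀ n, ∃ s : Plane, ‖s‖ = 1 ∧ ‖act (seqProd B n) s‖ ≤ 1 := fun n => by
    obtain ⟨s, h1, h2⟩ := exists_contracted (seqProd B n)
    exact ⟨s, h1, h2.trans (inv_le_one_of_one_le₀ (one_le_opNorm _))⟩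
  choose s hs hs' using hex
  obtain ⟨a, ha, φ, hφ, hlim⟩ := (isCompact_sphere (0 : Plane) 1).tendsto_subseq
    (x := s) (fun n => by simpa using hs n)
  refine ⟨a, ?_, by simpa using ha⟩
  have hK : 0 ≤ K := by
    have := h 0 (s 0)
    simp only [Finset.range_zero, Finset.sum_empty, hs] at this
    by_contra! hneg
    nlinarith [sq_nonneg ‖act (seqProd B 0) (s 0)‖]
  have hbound : ∀ m, ∑ i ∈ Finset.range m, ‖act (seqProd B i) a‖ ^ 2 ≤ K * 2 := by
    intro m
    have hc : Continuous fun v => ∑ i ∈ Finset.range m, ‖act (seqProd B i) v‖ ^ 2 :=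
      continuous_finsetSum _ fun i _ => ((continuous_act _).norm.pow 2)
    refine le_of_tendsto ((hc.tendsto a).comp hlim) ?_
    filter_upwards [eventually_ge_atTop m] with k hk
    have hmk : m ≤ φ k := hk.trans (hφ.id_le k)
    calc ∑ i ∈ Finset.range m, ‖act (seqProd B i) (s (φ k))‖ ^ 2
        ≤ ∑ i ∈ Finset.range (φ k), ‖act (seqProd B i) (s (φ k))‖ ^ 2 :=
          Finset.sum_le_sum_of_subset_of_nonneg (by simpa using hmk) fun _ _ _ => sq_nonneg _
      _ ≤ K * (‖s (φ k)‖ ^ 2 + ‖act (seqProd B (φ k)) (s (φ k))‖ ^ 2) := h _ _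
      _ ≤ K * 2 := by
        gcongr
        have : ‖act (seqProd B (φ k)) (s (φ k))‖ ^ 2 ≤ 1 ^ 2 := by gcongr; exact hs' _
        rw [hs]
        linarith
  have hsum : Summable fun i => ‖act (seqProd B i) a‖ ^ 2 :=
    summable_of_sum_range_le (fun _ => sq_nonneg _) hbound
  have h0 := hsum.tendsto_atTop_zero
  rw [mem_stableSpace, tendsto_zero_iff_norm_tendsto_zero]
  have := h0.sqrt
  simpa [Real.sqrt_sq] using this

/-- The tails `S m = ∑ x (m + i)` satisfy `S m ≤ K (S m - S (m + 1))`, so they decay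
geometrically. -/
theorem le_geometric_of_sum_le {x : ℕ → ℝ} {K : ℝ} (hK : 0 < K) (hx : ∀ n, 0 ≤ x n)
    (hlim : Tendsto x atTop (𝓝 0))
    (h : ∀ m n, ∑ i ∈ Finset.range n, x (m + i) ≤ K * (x m + x (m + n))) (n : ℕ) :
    x n ≤ K * (K / (K + 1)) ^ n * x 0 := by
  have hsum : Summable x := by
    obtain ⟨M, hM⟩ := hlim.bddAbove_range
    refine summable_of_sum_range_le (c := K * (x 0 + M)) hx fun n => ?_
    have := h 0 n
    simp only [zero_add] at this
    refine this.trans ?_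
    gcongr
    exact hM ⟨n, rfl⟩
  set S : ℕ → ℝ := fun m => ∑' i, x (m + i) with hS
  have hsm : ∀ m, Summable fun i => x (m + i) := fun m => by
    simpa [add_comm] using (summable_nat_add_iff m).2 hsum
  have hSx : ∀ m, S m ≤ K * x m := by
    intro m
    have h1 := (hsm m).hasSum.tendsto_sum_nat
    have h2 : Tendsto (fun n => K * (x m + x (m + n))) atTop (𝓝 (K * (x m + 0))) := by
      refine (tendsto_const_nhds.add (hlim.comp ?_)).const_mul K
      exact tendsto_atTop_mono (fun n => Nat.le_add_left n m) tendsto_id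
    rw [add_zero] at h2
    exact le_of_tendsto_of_tendsto' h1 h2 (h m)
  have hSsucc : ∀ m, S m = x m + S (m + 1) := by
    intro m
    have := (hsm m).tsum_eq_zero_add
    simp only [hS]
    rw [this]
    simp [add_left_comm, add_comm]
  have hS0 : ∀ m, 0 ≤ S m := fun m => tsum_nonneg fun i => hx _
  have hgeo : ∀ m, S m ≤ (K / (K + 1)) ^ m * S 0 := by
    intro m
    induction m with
    | zero => simp
    | succ m ih =>
      have h1 : S (m + 1) ≤ K / (K + 1) * S m := by
        rw [div_mul_eq_mul_div, le_div_iff₀ (by positivity)]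
        have h2 := hSx m
        have h3 := hSsucc m
        have h4 := hS0 (m + 1)
        have h5 : K * S m = K * x m + K * S (m + 1) := by rw [h3, mul_add]
        linarith [hx m]
      calc S (m + 1) ≤ K / (K + 1) * S m := h1
        _ ≤ K / (K + 1) * ((K / (K + 1)) ^ m * S 0) := by gcongr
        _ = _ := by ring
  calc x n ≤ S n := by rw [hSsucc]; linarith [hS0 (n + 1)]
    _ ≤ (K / (K + 1)) ^ n * S 0 := hgeo n
    _ ≤ (K / (K + 1)) ^ n * (K * x 0) := by gcongr; exact hSx 0
    _ = _ := by ring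

theorem norm_act_le_of_mem_stableSpace {K : ℝ} (hK : 0 < K) {B : ℕ → SL(2, ℝ)}
    (h : ∀ m, EndControl K fun i => B (m + i)) {v : Plane} (hv : v ∈ stableSpace B) (n : ℕ) :
    ‖act (seqProd B n) v‖ ≤ Real.sqrt K * Real.sqrt (K / (K + 1)) ^ n * ‖v‖ := by
  have key := le_geometric_of_sum_le (x := fun n => ‖act (seqProd B n) v‖ ^ 2) hK
    (fun _ => sq_nonneg _) (by simpa using hv.norm.pow 2) (fun m n => ?_) n
  · have h0 : act (seqProd B 0) v = v := act_one v
    rw [h0] at key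
    apply le_of_sq_le_sq _ (by positivity)
    rwa [mul_pow, mul_pow, Real.sq_sqrt hK.le, ← pow_mul, mul_comm n 2, pow_mul,
      Real.sq_sqrt (by positivity)]
  · have := h m n (act (seqProd B m) v)
    simpa only [← act_mul, ← seqProd_add] using this

theorem not_mem_stableSpace_of_wedge_ne_zero {B : ℕ → SL(2, ℝ)} {s v : Plane}
    (hs : s ∈ stableSpace B) (h : wedge s v ≠ 0) : v ∉ stableSpace B := by
  intro hv
  have h1 : Tendsto (fun n => ‖act (seqProd B n) s‖ * ‖act (seqProd B n) v‖) atTop (𝓝 (0 * 0)) := by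
    have := hs.norm.mul hv.norm
    simpa using this
  rw [mul_zero] at h1
  have h2 : |wedge s v| ≤ 0 := ge_of_tendsto' h1 fun n => by
    rw [← wedge_act (seqProd B n)]; exact abs_wedge_le _ _
  exact h (abs_nonpos_iff.1 h2)

theorem stableSpace_eq_span {B : ℕ → SL(2, ℝ)} {s : Plane} (hs : s ∈ stableSpace B)
    (hs0 : s ≠ 0) : stableSpace B = Submodule.span ℝ {s} := by
  refine le_antisymm (fun v hv => ?_) ((Submodule.span_singleton_le_iff_mem _ _).2 hs)
  by_contra hcon
  refine not_mem_stableSpace_of_wedge_ne_zero hs (v := v) (fun h => hcon ?_) hv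
  obtain ⟨c, rfl⟩ := exists_smul_of_wedge_eq_zero hs0 (by rw [wedge_swap, h, neg_zero] :
    wedge v s = 0)
  exact Submodule.smul_mem _ _ (Submodule.mem_span_singleton_self s)

/-- The linear map `1 - MᵀM / tr (MᵀM)`, which is close to the projection to the direction most
contracted by `M` when `M` is large. -/
noncomputable def contractedProj (M : SL(2, ℝ)) (v : Plane) : Plane :=
  !₂[v 0 - dot (act M !₂[1, 0]) (act M v) / (‖act M !₂[1, 0]‖ ^ 2 + ‖act M !₂[0, 1]‖ ^ 2),
    v 1 - dot (act M !₂[0, 1]) (act M v) / (‖act M !₂[1, 0]‖ ^ 2 + ‖act M !₂[0, 1]‖ ^ 2)]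

theorem tendsto_contractedProj {B : ℕ → SL(2, ℝ)} {s : Plane} (hs : s ∈ stableSpace B)
    (hs1 : ‖s‖ = 1) (v : Plane) :
    Tendsto (fun n => contractedProj (seqProd B n) v) atTop (𝓝 (dot s v • s)) := by
  set t := quarterTurn s with ht
  have hst : s 0 ^ 2 + s 1 ^ 2 = 1 := by rw [← norm_sq_plane, hs1, one_pow]
  have ht0 : t 0 = -s 1 := rfl
  have ht1 : t 1 = s 0 := rfl
  set p := fun n => ‖act (seqProd B n) s‖ ^ 2 with hp
  set q := fun n => ‖act (seqProd B n) t‖ ^ 2 with hq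
  set r := fun n => dot (act (seqProd B n) s) (act (seqProd B n) t) with hr
  have hpq : ∀ n, r n ^ 2 + 1 = p n * q n := by
    intro n
    have := dot_sq_add_wedge_sq (act (seqProd B n) s) (act (seqProd B n) t)
    rw [wedge_act] at this
    have hw : wedge s t = 1 := by rw [wedge, ht0, ht1]; linarith
    rwa [hw, one_pow] at this
  have hp0 : ∀ n, 0 ≤ p n := fun n => sq_nonneg _
  have hq0 : ∀ n, 0 ≤ q n := fun n => sq_nonneg _
  have hD : ∀ n, 1 ≤ p n + q n := by
    intro n
    nlinarith [hpq n, sq_nonneg (p n - q n), sq_nonneg (r n), hp0 n, hq0 n]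
  have hplim : Tendsto p atTop (𝓝 0) := by simpa using hs.norm.pow 2
  have hlim1 : Tendsto (fun n => p n / (p n + q n)) atTop (𝓝 0) :=
    squeeze_zero (fun n => div_nonneg (hp0 n) (by linarith [hD n]))
      (fun n => div_le_self (hp0 n) (hD n)) hplim
  have hlim2 : Tendsto (fun n => r n / (p n + q n)) atTop (𝓝 0) := by
    refine squeeze_zero_norm (a := fun n => Real.sqrt (p n)) (fun n => ?_)
      (by simpa using hplim.sqrt)
    rw [Real.norm_eq_abs]
    apply Real.abs_le_sqrt
    rw [div_pow, div_le_iff₀ (by have := hD n; positivity)]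
    have h1 := hpq n
    have h2 := hD n
    nlinarith [mul_nonneg (hp0 n) (hq0 n), mul_nonneg (hp0 n) (mul_nonneg (hp0 n) (hp0 n)),
      mul_nonneg (mul_nonneg (hp0 n) (hq0 n)) (sub_nonneg.2 h2),
      mul_nonneg (mul_nonneg (hp0 n) (hp0 n)) (sub_nonneg.2 h2), mul_nonneg (hp0 n) (hp0 n)]
  have hlim3 : Tendsto (fun n => q n / (p n + q n)) atTop (𝓝 1) := by
    have : Tendsto (fun n => 1 - p n / (p n + q n)) atTop (𝓝 (1 - 0)) :=
      tendsto_const_nhds.sub hlim1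
    rw [sub_zero] at this
    refine this.congr fun n => ?_
    have := hD n
    field_simp
    ring
  -- the matrix of `MᵀM` in the basis `s, t`
  have hexp : ∀ (n : ℕ) (a b c d : ℝ), dot (act (seqProd B n) (a • s + b • t))
      (act (seqProd B n) (c • s + d • t)) = a * c * p n + (a * d + b * c) * r n + b * d * q n := by
    intro n a b c d
    simp only [map_add, map_smul, hp, hq, hr, norm_sq_plane, dot, PiLp.add_apply,
      PiLp.smul_apply, smul_eq_mul]
    ring
  have he0 : (!₂[1, 0] : Plane) = s 0 • s + t 0 • t := by
    apply plane_ext <;> simp [ht0, ht1]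
    · linarith
    · ring
  have he1 : (!₂[0, 1] : Plane) = s 1 • s + t 1 • t := by
    apply plane_ext <;> simp [ht0, ht1]
    · ring
    · linarith
  have hv := eq_dot_smul_add_wedge_smul hs1 v
  rw [← ht] at hv
  have htr : ∀ n, ‖act (seqProd B n) !₂[1, 0]‖ ^ 2 + ‖act (seqProd B n) !₂[0, 1]‖ ^ 2
      = p n + q n := by
    intro n
    rw [← dot_self, ← dot_self, he0, he1, hexp, hexp, ht0, ht1]
    linear_combination (p n + q n) * hst
  have hcoord : ∀ a b : ℝ, Tendsto (fun n => dot (act (seqProd B n) (a • s + b • t))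
      (act (seqProd B n) v) / (p n + q n)) atTop (𝓝 (b * wedge s v)) := by
    intro a b
    have h1 := ((hlim1.const_mul (a * dot s v)).add
      (hlim2.const_mul (a * wedge s v + b * dot s v))).add (hlim3.const_mul (b * wedge s v))
    simp only [mul_zero, zero_add, mul_one] at h1
    refine h1.congr fun n => ?_
    conv_rhs => rw [hv]
    rw [hexp]
    ring
  have hlimit : dot s v • s = !₂[v 0 - t 0 * wedge s v, v 1 - t 1 * wedge s v] := by
    have hv0 : v 0 = dot s v * s 0 + wedge s v * t 0 := by
      conv_lhs => rw [hv]
      simp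
    have hv1 : v 1 = dot s v * s 1 + wedge s v * t 1 := by
      conv_lhs => rw [hv]
      simp
    apply plane_ext <;> simp
    · linarith
    · linarith
  rw [hlimit]
  simp only [contractedProj, htr]
  refine (PiLp.continuous_toLp 2 _).continuousAt.tendsto.comp ?_
  rw [tendsto_pi_nhds]
  intro i
  fin_cases i
  · simpa [he0] using (hcoord (s 0) (t 0)).const_sub (v 0)
  · simpa [he1] using (hcoord (s 1) (t 1)).const_sub (v 1)

theorem tendsto_contractedProj_starProjection {B : ℕ → SL(2, ℝ)} {s : Plane}
    (hs : s ∈ stableSpace B) (hs1 : ‖s‖ = 1) (v : Plane) :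
    Tendsto (fun n => contractedProj (seqProd B n) v) atTop
      (𝓝 ((stableSpace B).starProjection v)) := by
  have h := tendsto_contractedProj hs hs1 v
  have hs0 : s ≠ 0 := by rintro rfl; simp at hs1
  simp only [stableSpace_eq_span hs hs0]
  rw [Submodule.starProjection_unit_singleton ℝ hs1]
  convert h using 3
  simp [PiLp.inner_apply, dot, mul_comm]

variable {X : Type*} [MeasurableSpace X]

/-! ### A criterion for uniform hyperbolicity -/

/-- The sequence of matrices seen along the forward orbit of `x`. -/
def orbitSeq (T : X ≃ᵐ X) (A : X → SL(2, ℝ)) (x : X) (i : ℕ) : SL(2, ℝ) := A (T^[i] x)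

theorem iterFwd_eq_seqProd (T : X ≃ᵐ X) (A : X → SL(2, ℝ)) (n : ℕ) (x : X) :
    iterFwd T A n x = seqProd (orbitSeq T A x) n := by
  induction n with
  | zero => rfl
  | succ n ih => rw [iterFwd, seqProd, ih, orbitSeq]

theorem orbitSeq_iterate (T : X ≃ᵐ X) (A : X → SL(2, ℝ)) (m : ℕ) (x : X) :
    orbitSeq T A (T^[m] x) = fun i => orbitSeq T A x (m + i) := by
  funext i
  rw [orbitSeq, orbitSeq, ← Function.iterate_add_apply, add_comm]

theorem iterFwd_add (T : X ≃ᵐ X) (A : X → SL(2, ℝ)) (m n : ℕ) (x : X) :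
    iterFwd T A (m + n) x = iterFwd T A n (T^[m] x) * iterFwd T A m x := by
  rw [iterFwd_eq_seqProd, iterFwd_eq_seqProd, iterFwd_eq_seqProd, seqProd_add, orbitSeq_iterate]

/-- The inverse cocycle, over the inverse automorphism. -/
noncomputable def invCocycle (T : X ≃ᵐ X) (A : X → SL(2, ℝ)) (x : X) : SL(2, ℝ) := (A (T.symm x))⁻¹

theorem iterFwd_invCocycle (T : X ≃ᵐ X) (A : X → SL(2, ℝ)) (n : ℕ) (x : X) :
    iterFwd T.symm (invCocycle T A) n x = iterBwd T A n x := by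
  induction n with
  | zero => rfl
  | succ n ih => rw [iterFwd, iterBwd, ih, invCocycle, Function.iterate_succ_apply']

theorem iter_neg_natCast (T : X ≃ᵐ X) (A : X → SL(2, ℝ)) (n : ℕ) (x : X) :
    iter T A (-(n : ℤ)) x = iterBwd T A n x := by
  cases n with
  | zero => rfl
  | succ n => rfl

theorem iterate_symm_apply (T : X ≃ᵐ X) (i j : ℕ) (x : X) :
    T^[i] (T.symm^[i + j] x) = T.symm^[j] x := by
  rw [Function.iterate_add_apply]
  exact (Function.LeftInverse.iterate (fun y => T.apply_symm_apply y) i) _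

/-- Going back `i + j` steps and then forward `i` steps. -/
theorem iterFwd_mul_iterBwd (T : X ≃ᵐ X) (A : X → SL(2, ℝ)) (i j : ℕ) (x : X) :
    iterFwd T A i (T.symm^[i + j] x) * iterBwd T A (i + j) x = iterBwd T A j x := by
  induction i generalizing j with
  | zero => simp [iterFwd]
  | succ i ih =>
    rw [iterFwd, mul_assoc, show i + 1 + j = i + (j + 1) by ring, ih (j + 1), iterate_symm_apply,
      iterBwd, mul_inv_cancel_left]

/-- Control by the ends is symmetric under time reversal, up to a change of the constant: an orbit
segment of the inverse cocycle is one of the cocycle, read backwards. -/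
theorem orbitSeq_endControl_invCocycle {T : X ≃ᵐ X} {A : X → SL(2, ℝ)} {K : ℝ}
    {x : X} (h : ∀ n, EndControl K (orbitSeq T A (T.symm^[n] x))) :
    EndControl (K + 1) (orbitSeq T.symm (invCocycle T A) x) := by
  intro n v
  simp only [← iterFwd_eq_seqProd, iterFwd_invCocycle]
  have h1 := h n n (act (iterBwd T A n x) v)
  simp only [← iterFwd_eq_seqProd, ← act_mul] at h1
  have h2 := iterFwd_mul_iterBwd T A n 0 x
  rw [add_zero] at h2
  rw [h2] at h1
  have h3 : ∑ i ∈ Finset.range n, ‖act (iterFwd T A i (T.symm^[n] x) * iterBwd T A n x) v‖ ^ 2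
      = ∑ i ∈ Finset.range n, ‖act (iterBwd T A (i + 1) x) v‖ ^ 2 := by
    rw [← Finset.sum_range_reflect (fun i => ‖act (iterBwd T A (i + 1) x) v‖ ^ 2)]
    refine Finset.sum_congr rfl fun i hi => ?_
    have hi' := Finset.mem_range.1 hi
    have h4 := iterFwd_mul_iterBwd T A i (n - i) x
    rw [Nat.add_sub_cancel' hi'.le] at h4
    rw [h4, show n - 1 - i + 1 = n - i by omega]
  rw [h3] at h1
  have e0 : act (iterBwd T A 0 x) v = v := act_one v
  rw [e0] at h1
  have h5 := Finset.sum_range_succ (fun i => ‖act (iterBwd T A i x) v‖ ^ 2) n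
  rw [Finset.sum_range_succ', e0] at h5
  nlinarith [sq_nonneg ‖act (iterBwd T A n x) v‖]

/-- The space of vectors whose forward orbit under the cocycle tends to zero. -/
def stableField (T : X ≃ᵐ X) (A : X → SL(2, ℝ)) (x : X) : Submodule ℝ Plane :=
  stableSpace (orbitSeq T A x)

theorem act_mem_stableField (T : X ≃ᵐ X) (A : X → SL(2, ℝ)) (x : X) (v : Plane) :
    act (A x) v ∈ stableField T A (T x) ↔ v ∈ stableField T A x := by
  rw [stableField, stableField, mem_stableSpace, mem_stableSpace,
    ← tendsto_add_atTop_iff_nat (f := fun n => act (seqProd (orbitSeq T A x) n) v) 1]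
  refine tendsto_congr fun n => ?_
  rw [← iterFwd_eq_seqProd, ← iterFwd_eq_seqProd, add_comm n 1, iterFwd_add, act_mul]
  simp [iterFwd]

theorem map_stableField (T : X ≃ᵐ X) (A : X → SL(2, ℝ)) (x : X) :
    (stableField T A x).map (act (A x)) = stableField T A (T x) := by
  ext w
  rw [Submodule.mem_map]
  constructor
  · rintro ⟨v, hv, rfl⟩
    exact (act_mem_stableField T A x v).2 hv
  · intro hw
    exact ⟨act (A x)⁻¹ w, (act_mem_stableField T A x _).1 (by rwa [act_act_inv]), act_act_inv _ _⟩

theorem map_stableField_invCocycle (T : X ≃ᵐ X) (A : X → SL(2, ℝ)) (x : X) :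
    (stableField T.symm (invCocycle T A) x).map (act (A x))
      = stableField T.symm (invCocycle T A) (T x) := by
  have h := map_stableField T.symm (invCocycle T A) (T x)
  rw [T.symm_apply_apply] at h
  rw [← h, invCocycle, T.symm_apply_apply, ← Submodule.map_comp]
  have : act (A x) ∘ₗ act (A x)⁻¹ = LinearMap.id := LinearMap.ext fun v => act_act_inv _ v
  rw [this, Submodule.map_id]

theorem stronglyMeasurable_iterFwd {T : X ≃ᵐ X} {A : X → SL(2, ℝ)} (hA : StronglyMeasurable A)
    (n : ℕ) : StronglyMeasurable (iterFwd T A n) := by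
  induction n with
  | zero => exact stronglyMeasurable_const
  | succ n ih => exact (hA.comp_measurable (T.measurable.iterate n)).mul ih

theorem measurable_act {A : X → SL(2, ℝ)} (hA : StronglyMeasurable A) (v : Plane) (i : Fin 2) :
    Measurable fun x => act (A x) v i := by
  have hc : ∀ i j, Measurable fun x => (A x : Matrix (Fin 2) (Fin 2) ℝ) i j := fun i j =>
    (Continuous.comp_stronglyMeasurable
      (g := fun M : SL(2, ℝ) => (M : Matrix (Fin 2) (Fin 2) ℝ) i j)
      (continuous_subtype_val.matrix_elem i j) hA).measurable
  fin_cases i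
  · simp only [Fin.zero_eta, act_zero_coord]
    exact ((hc 0 0).mul_const _).add ((hc 0 1).mul_const _)
  · simp only [Fin.mk_one, act_one_coord]
    exact ((hc 1 0).mul_const _).add ((hc 1 1).mul_const _)

theorem measurable_contractedProj {A : X → SL(2, ℝ)} (hA : StronglyMeasurable A) (v : Plane) :
    Measurable fun x => contractedProj (A x) v := by
  have h := measurable_act hA
  refine (WithLp.measurable_toLp 2 _).comp (measurable_pi_lambda _ fun i => ?_)
  have hn : ∀ u : Plane, Measurable fun x => ‖act (A x) u‖ ^ 2 := fun u => by
    simp only [norm_sq_plane]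
    exact ((h u 0).pow_const 2).add ((h u 1).pow_const 2)
  have hd : ∀ u : Plane, Measurable fun x => dot (act (A x) u) (act (A x) v) := fun u =>
    ((h u 0).mul (h v 0)).add ((h u 1).mul (h v 1))
  fin_cases i
  · exact ((hd _).div ((hn _).add (hn _))).const_sub _
  · exact ((hd _).div ((hn _).add (hn _))).const_sub _

theorem aemeasurableField_stableField {μ : Measure X} {T : X ≃ᵐ X} {A : X → SL(2, ℝ)}
    (hA : StronglyMeasurable A) (h : ∀ᵐ x ∂μ, ∃ s ∈ stableField T A x, ‖s‖ = 1) :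
    AEMeasurableField μ (stableField T A) := by
  intro v
  refine aemeasurable_of_tendsto_metrizable_ae atTop
    (fun n => (measurable_contractedProj (stronglyMeasurable_iterFwd (T := T) hA n) v).aemeasurable)
    ?_
  filter_upwards [h] with x hx
  obtain ⟨s, hs, hs1⟩ := hx
  simp only [iterFwd_eq_seqProd]
  exact tendsto_contractedProj_starProjection hs hs1 v

/-- No nonzero vector is contracted both in the future and in the past. -/
theorem stableField_inf_eq_bot {T : X ≃ᵐ X} {A : X → SL(2, ℝ)} {K : ℝ}
    {x : X} (h : ∀ n, EndControl K (orbitSeq T A (T.symm^[n] x))) {v : Plane}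
    (hs : v ∈ stableField T A x) (hu : v ∈ stableField T.symm (invCocycle T A) x) : v = 0 := by
  have h1 : Tendsto (fun n => K * (‖act (iterBwd T A n x) v‖ ^ 2 + ‖act (iterFwd T A n x) v‖ ^ 2))
      atTop (𝓝 (K * (‖(0 : Plane)‖ ^ 2 + ‖(0 : Plane)‖ ^ 2))) := by
    have e1 := mem_stableSpace.1 hs
    have e2 := mem_stableSpace.1 hu
    simp only [← iterFwd_eq_seqProd, iterFwd_invCocycle] at e1 e2
    exact ((e2.norm.pow 2).add (e1.norm.pow 2)).const_mul K
  have h2 : ‖v‖ ^ 2 ≤ K * (‖(0 : Plane)‖ ^ 2 + ‖(0 : Plane)‖ ^ 2) := by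
    refine ge_of_tendsto h1 ?_
    filter_upwards [eventually_ge_atTop 1] with n hn
    have h3 := h n (n + n) (act (iterBwd T A n x) v)
    simp only [← iterFwd_eq_seqProd, ← act_mul] at h3
    have e0 := iterFwd_mul_iterBwd T A n 0 x
    have e1 := iterate_symm_apply T n 0 x
    rw [add_zero] at e0 e1
    rw [iterFwd_add, mul_assoc, e0, e1] at h3
    have e2 : iterFwd T A n (T.symm^[0] x) * iterBwd T A 0 x = iterFwd T A n x := mul_one _
    rw [e2] at h3
    refine le_trans ?_ h3
    have h4 := Finset.single_le_sum (f := fun i =>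
      ‖act (iterFwd T A i (T.symm^[n] x) * iterBwd T A n x) v‖ ^ 2) (fun i _ => sq_nonneg _)
      (Finset.mem_range.2 (by omega : n < n + n))
    refine le_trans (le_of_eq ?_) h4
    rw [e0]
    exact congrArg (‖·‖ ^ 2) (act_one v).symm
  simpa using h2

/-- A cocycle whose orbit segments are uniformly controlled by their ends is uniformly hyperbolic:
the invariant spaces consist of the vectors that tend to zero in the future and in the past. -/
theorem isUniformlyHyperbolic_of_endControl {μ : Measure X} {T : X ≃ᵐ X}
    (hT : MeasurePreserving T μ μ) {A : X → SL(2, ℝ)} (hA : StronglyMeasurable A) {K : ℝ}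
    (hK : 0 < K) (h : ∀ᵐ x ∂μ, EndControl K (orbitSeq T A x)) :
    IsUniformlyHyperbolic μ T A := by
  have hT' : MeasurePreserving T.symm μ μ := hT.symm
  have hA' : StronglyMeasurable (invCocycle T A) := (hA.comp_measurable T.symm.measurable).inv
  have hf : ∀ᵐ x ∂μ, ∀ n, EndControl K (orbitSeq T A (T^[n] x)) :=
    ae_all_iff.2 fun n => (hT.iterate n).quasiMeasurePreserving.ae h
  have hb : ∀ᵐ x ∂μ, ∀ n, EndControl K (orbitSeq T A (T.symm^[n] x)) :=
    ae_all_iff.2 fun n => (hT'.iterate n).quasiMeasurePreserving.ae h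
  have hi : ∀ᵐ x ∂μ, EndControl (K + 1) (orbitSeq T.symm (invCocycle T A) x) :=
    hb.mono fun x hx => orbitSeq_endControl_invCocycle hx
  have hif : ∀ᵐ x ∂μ, ∀ n, EndControl (K + 1) (orbitSeq T.symm (invCocycle T A) (T.symm^[n] x)) :=
    ae_all_iff.2 fun n => (hT'.iterate n).quasiMeasurePreserving.ae hi
  have hK1 : 0 < K + 1 := by linarith
  refine ⟨stableField T.symm (invCocycle T A), stableField T A,
    aemeasurableField_stableField hA' (hi.mono fun x hx => exists_mem_stableSpace hx),
    aemeasurableField_stableField hA (h.mono fun x hx => exists_mem_stableSpace hx), ?_,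
    Eventually.of_forall fun x => ⟨map_stableField_invCocycle T A x, map_stableField T A x⟩, ?_⟩
  · filter_upwards [h, hi, hb] with x h1 h2 h3
    obtain ⟨s, hs, hs1⟩ := exists_mem_stableSpace h1
    obtain ⟨u, hu, hu1⟩ := exists_mem_stableSpace h2
    have hs0 : s ≠ 0 := by rintro rfl; simp at hs1
    have hsu : wedge s u ≠ 0 := fun h0 => by
      obtain ⟨c, hc⟩ := exists_smul_of_wedge_eq_zero (by rintro rfl; simp at hu1) h0
      exact hs0 (stableField_inf_eq_bot h3 hs (hc ▸ Submodule.smul_mem _ c hu))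
    refine ⟨Submodule.disjoint_def.2 fun v hv hv' => stableField_inf_eq_bot h3 hv' hv,
      codisjoint_iff.2 (Submodule.eq_top_iff'.2 fun v => Submodule.mem_sup.2
        ⟨(wedge s v / wedge s u) • u, Submodule.smul_mem _ _ hu,
         (wedge v u / wedge s u) • s, Submodule.smul_mem _ _ hs, ?_⟩)⟩
    apply plane_ext <;> simp only [PiLp.add_apply, PiLp.smul_apply, smul_eq_mul] <;>
      field_simp <;> simp only [wedge] <;> ring
  · set τ := Real.sqrt ((K + 1) / (K + 1 + 1)) with hτ
    have hτ0 : 0 < τ := Real.sqrt_pos.2 (by positivity)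
    have hτ1 : τ < 1 := by
      rw [hτ, Real.sqrt_lt' one_pos, one_pow, div_lt_one (by positivity)]; linarith
    have hττ : Real.sqrt (K / (K + 1)) ≤ τ := by
      apply Real.sqrt_le_sqrt
      rw [div_le_div_iff₀ (by positivity) (by positivity)]
      nlinarith
    refine ⟨Real.sqrt (K + 1), τ, Real.sqrt_pos.2 hK1, hτ0, hτ1, ?_⟩
    filter_upwards [hf, hif] with x h1 h2 n
    refine ⟨fun v hv => ?_, fun v hv => ?_⟩
    · change ‖act (iterFwd T A n x) v‖ ≤ _
      rw [iterFwd_eq_seqProd]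
      refine (norm_act_le_of_mem_stableSpace hK
        (fun m => orbitSeq_iterate T A m x ▸ h1 m) hv n).trans ?_
      gcongr
      linarith
    · rw [iter_neg_natCast, ← iterFwd_invCocycle, iterFwd_eq_seqProd]
      exact norm_act_le_of_mem_stableSpace hK1
        (fun m => orbitSeq_iterate T.symm _ m x ▸ h2 m) hv n

/-! ### Visits and Rokhlin towers -/

theorem IsNonatomic.exists_measure_lt {μ : Measure X} [IsProbabilityMeasure μ]
    (hμ : IsNonatomic μ) {ε : ℝ≥0∞} (hε : 0 < ε) :
    ∃ D : Set X, MeasurableSet D ∧ 0 < μ D ∧ μ D < ε := by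
  have key : ∀ n : ℕ, ∃ D : Set X, MeasurableSet D ∧ 0 < μ D ∧ μ D ≤ (2⁻¹ : ℝ≥0∞) ^ n := by
    intro n
    induction n with
    | zero => exact ⟨Set.univ, MeasurableSet.univ, by simp, by simp⟩
    | succ n ih =>
      obtain ⟨D, hD, h0, hn⟩ := ih
      obtain ⟨t, htD, ht, ht0, htlt⟩ := hμ D hD h0
      have hhalf : 2⁻¹ * μ D ≤ (2⁻¹ : ℝ≥0∞) ^ (n + 1) := by
        rw [pow_succ']; gcongr
      rcases le_or_gt (μ t) (2⁻¹ * μ D) with h | h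
      · exact ⟨t, ht, ht0, h.trans hhalf⟩
      · have hdiff : μ (D \ t) = μ D - μ t :=
          measure_sdiff htD ht.nullMeasurableSet (measure_ne_top μ t)
        refine ⟨D \ t, hD.diff ht, by rw [hdiff]; exact tsub_pos_of_lt htlt, ?_⟩
        rw [hdiff]
        refine le_trans ?_ hhalf
        rw [tsub_le_iff_right]
        calc μ D = 2⁻¹ * μ D + 2⁻¹ * μ D := by
              rw [← add_mul, ENNReal.inv_two_add_inv_two, one_mul]
          _ ≤ _ := by gcongr
  have hlim := ENNReal.tendsto_pow_atTop_nhds_zero_of_lt_one (r := 2⁻¹)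
    (ENNReal.inv_lt_one.2 ENNReal.one_lt_two)
  obtain ⟨n, hn⟩ := (hlim.eventually (gt_mem_nhds hε)).exists
  obtain ⟨D, hD, h0, h1⟩ := key n
  exact ⟨D, hD, h0, h1.trans_lt hn⟩

/-- The points that do not visit `Y` during the times `0, …, n - 1`. -/
def avoiding (T : X ≃ᵐ X) (Y : Set X) (n : ℕ) : Set X := {x | ∀ i < n, T^[i] x ∉ Y}

theorem measurableSet_avoiding (T : X ≃ᵐ X) {Y : Set X} (hY : MeasurableSet Y) (n : ℕ) :
    MeasurableSet (avoiding T Y n) := by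
  have : avoiding T Y n = ⋂ i ∈ Set.Iio n, T^[i] ⁻¹' Yᶜ := by
    ext x; simp [avoiding]
  rw [this]
  exact MeasurableSet.biInter (Set.to_countable _) fun i _ => (T.measurable.iterate i) hY.compl

theorem measure_never_visit {μ : Measure X} [IsProbabilityMeasure μ] {T : X ≃ᵐ X}
    (hT : Ergodic T μ) {Y : Set X} (hY : MeasurableSet Y) (h0 : 0 < μ Y) :
    μ (⋂ n, avoiding T Y n) = 0 := by
  have hm : MeasurableSet (⋂ n, avoiding T Y n) :=
    MeasurableSet.iInter fun n => measurableSet_avoiding T hY n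
  have hinv : (⋂ n, avoiding T Y n) ⊆ T ⁻¹' (⋂ n, avoiding T Y n) := by
    intro x hx
    simp only [Set.mem_iInter, Set.mem_preimage] at hx ⊢
    intro n i hi
    rw [← Function.iterate_succ_apply]
    exact hx (n + 1) (i + 1) (by omega)
  rcases hT.ae_empty_or_univ_of_ae_le_preimage hm.nullMeasurableSet
    (LE.le.eventuallyLE hinv) with h | h
  · rw [measure_congr h, measure_empty]
  · exfalso
    have hsub : (⋂ n, avoiding T Y n) ⊆ Yᶜ := fun x hx hxY => (Set.mem_iInter.1 hx 1) 0 one_pos hxY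
    have h1 : μ Yᶜ = 1 := by
      refine le_antisymm prob_le_one ?_
      calc (1 : ℝ≥0∞) = μ Set.univ := measure_univ.symm
        _ = μ (⋂ n, avoiding T Y n) := (measure_congr h).symm
        _ ≤ _ := measure_mono hsub
    rw [prob_compl_eq_one_iff hY] at h1
    exact h0.ne' h1

theorem tendsto_measure_avoiding {μ : Measure X} [IsProbabilityMeasure μ] {T : X ≃ᵐ X}
    (hT : Ergodic T μ) {Y : Set X} (hY : MeasurableSet Y) (h0 : 0 < μ Y) :
    Tendsto (fun n => μ (avoiding T Y n)) atTop (𝓝 0) := by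
  have h := tendsto_measure_iInter_atTop (μ := μ)
    (fun n => (measurableSet_avoiding T hY n).nullMeasurableSet)
    (fun m n hmn x hx i hi => hx i (hi.trans_le hmn)) ⟨0, measure_ne_top μ _⟩
  rwa [measure_never_visit hT hY h0] at h

/-- The image of `E` under the `i`-th iterate of `T`. -/
def level (T : X ≃ᵐ X) (E : Set X) (i : ℕ) : Set X := T.symm^[i] ⁻¹' E

/-- The union of the first `N` images of `E`. -/
def tower (T : X ≃ᵐ X) (E : Set X) (N : ℕ) : Set X := ⋃ i ∈ Finset.range N, level T E i

/-- The first `N` images of `E` are disjoint. -/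
def IsTowerBase (T : X ≃ᵐ X) (E : Set X) (N : ℕ) : Prop :=
  ∀ i < N, ∀ j < N, i ≠ j → Disjoint (level T E i) (level T E j)

theorem measurableSet_level (T : X ≃ᵐ X) {E : Set X} (hE : MeasurableSet E) (i : ℕ) :
    MeasurableSet (level T E i) := (T.symm.measurable.iterate i) hE

theorem measurableSet_tower (T : X ≃ᵐ X) {E : Set X} (hE : MeasurableSet E) (N : ℕ) :
    MeasurableSet (tower T E N) := Finset.measurableSet_biUnion _ fun i _ => measurableSet_level T hE i

theorem mem_tower {T : X ≃ᵐ X} {E : Set X} {N : ℕ} {x : X} :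
    x ∈ tower T E N ↔ ∃ i < N, T.symm^[i] x ∈ E := by
  simp [tower, level]

theorem measure_level {μ : Measure X} {T : X ≃ᵐ X} (hT : MeasurePreserving T μ μ) {E : Set X}
    (hE : MeasurableSet E) (i : ℕ) : μ (level T E i) = μ E :=
  (hT.symm.iterate i).measure_preimage hE.nullMeasurableSet

theorem symm_iterate_iterate (T : X ≃ᵐ X) (i j : ℕ) (x : X) :
    T.symm^[i] (T^[i + j] x) = T^[j] x := iterate_symm_apply T.symm i j x

theorem symm_iterate_add_iterate (T : X ≃ᵐ X) (i j : ℕ) (x : X) :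
    T.symm^[i + j] (T^[i] x) = T.symm^[j] x := by
  rw [add_comm, Function.iterate_add_apply]
  congr 1
  exact symm_iterate_iterate T i 0 x

theorem iterate_add_symm_iterate (T : X ≃ᵐ X) (i j : ℕ) (x : X) :
    T^[i + j] (T.symm^[i] x) = T^[j] x := symm_iterate_add_iterate T.symm i j x

/-- The base is made of the points whose last visit to `D` happened a multiple of `N` steps ago,
and which have no visit to `D` in the next `N - 1` steps. -/
theorem exists_isTowerBase_of_visits {μ : Measure X} [IsProbabilityMeasure μ] {T : X ≃ᵐ X}
    (hT : Ergodic T μ) {D : Set X} (hD : MeasurableSet D) (h0 : 0 < μ D) {N : ℕ} (hN : 0 < N) :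
    ∃ E : Set X, MeasurableSet E ∧ IsTowerBase T E N ∧ μ (tower T E N)ᶜ ≤ N * μ D := by
  set L : ℕ → Set X := fun k => {x | T.symm^[k] x ∈ D ∧ ∀ j < k, T.symm^[j] x ∉ D} with hL
  have hLm : ∀ k, MeasurableSet (L k) := fun k => by
    have : L k = T.symm^[k] ⁻¹' D ∩ avoiding T.symm D k := by ext x; simp [hL, avoiding]
    rw [this]
    exact ((T.symm.measurable.iterate k) hD).inter (measurableSet_avoiding T.symm hD k)
  have huniq : ∀ {k l x}, x ∈ L k → x ∈ L l → k = l := by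
    intro k l x hk hl
    rcases lt_trichotomy k l with h | h | h
    · exact absurd hk.1 (hl.2 k h)
    · exact h
    · exact absurd hl.1 (hk.2 l h)
  refine ⟨(⋃ m, L (N * m)) ∩ ⋂ t ∈ Finset.Ico 1 N, (T^[t] ⁻¹' D)ᶜ, ?_, ?_, ?_⟩
  · exact (MeasurableSet.iUnion fun m => hLm _).inter
      (Finset.measurableSet_biInter _ fun t _ => ((T.measurable.iterate t) hD).compl)
  · have key : ∀ i j, i < j → j < N → ∀ x,
        T.symm^[i] x ∈ ⋃ m, L (N * m) → T.symm^[j] x ∈ ⋃ m, L (N * m) →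
        T.symm^[j] x ∈ ⋂ t ∈ Finset.Ico 1 N, (T^[t] ⁻¹' D)ᶜ → False := by
      intro i j hij hjN x hi hj hj'
      obtain ⟨m, hm⟩ := Set.mem_iUnion.1 hi
      obtain ⟨m', hm'⟩ := Set.mem_iUnion.1 hj
      obtain ⟨d, rfl⟩ := Nat.exists_eq_add_of_lt hij
      set e := T.symm^[i + d + 1] x with he
      have hee : T.symm^[i] x = T^[d + 1] e := by
        rw [he, show i + d + 1 = (d + 1) + i by ring, iterate_symm_apply]
      rw [hee] at hm
      have hmem : T^[d + 1] e ∈ L (d + 1 + N * m') := by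
        refine ⟨by rw [symm_iterate_add_iterate]; exact hm'.1, fun k hk => ?_⟩
        rcases Nat.lt_or_ge k (d + 1) with h | h
        · obtain ⟨a, ha⟩ := Nat.exists_eq_add_of_lt h
          rw [ha, add_assoc, symm_iterate_iterate]
          have := Set.mem_iInter₂.1 hj' (a + 1) (Finset.mem_Ico.2 ⟨by omega, by omega⟩)
          exact this
        · obtain ⟨a, rfl⟩ := Nat.exists_eq_add_of_le h
          rw [symm_iterate_add_iterate]
          exact hm'.2 a (by omega)
      have heq := huniq hm hmem
      have : (N * m) % N = (d + 1 + N * m') % N := by rw [heq]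
      rw [Nat.mul_mod_right, Nat.add_mul_mod_self_left, Nat.mod_eq_of_lt (by omega)] at this
      omega
    intro i hi j hj hij
    rw [Set.disjoint_left]
    intro x hxi hxj
    rcases lt_or_gt_of_ne hij with h | h
    · exact key i j h hj x hxi.1 hxj.1 hxj.2
    · exact key j i h hi x hxj.1 hxi.1 hxi.2
  · have hsub : (tower T ((⋃ m, L (N * m)) ∩ ⋂ t ∈ Finset.Ico 1 N, (T^[t] ⁻¹' D)ᶜ) N)ᶜ ⊆
        (⋂ n, avoiding T.symm D n) ∪ ⋃ r ∈ Finset.range N, T^[r] ⁻¹' D := by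
      classical
      intro x hx
      by_cases hv : ∃ k, T.symm^[k] x ∈ D
      · right
        set σ := Nat.find hv with hσ
        have hσ1 : T.symm^[σ] x ∈ D := Nat.find_spec hv
        have hσ2 : ∀ j < σ, T.symm^[j] x ∉ D := fun j hj => Nat.find_min hv hj
        have hlt : σ % N < N := Nat.mod_lt _ hN
        have hx' : T.symm^[σ % N] x ∉ ((⋃ m, L (N * m)) ∩ ⋂ t ∈ Finset.Ico 1 N, (T^[t] ⁻¹' D)ᶜ) :=
          fun h => hx (mem_tower.2 ⟨_, hlt, h⟩)
        have hmem : T.symm^[σ % N] x ∈ ⋃ m, L (N * m) := by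
          refine Set.mem_iUnion.2 ⟨σ / N, ?_, fun j hj => ?_⟩
          · rw [← Function.iterate_add_apply, Nat.div_add_mod]; exact hσ1
          · rw [← Function.iterate_add_apply]
            refine hσ2 _ ?_
            have := Nat.div_add_mod σ N
            omega
        have hex : ∃ t, (1 ≤ t ∧ t < N) ∧ T^[t] (T.symm^[σ % N] x) ∈ D := by
          by_contra! hcon
          exact hx' ⟨hmem, Set.mem_iInter₂.2 fun t ht => hcon t (Finset.mem_Ico.1 ht)⟩
        obtain ⟨t, ⟨ht1, htN⟩, ht⟩ := hex
        rcases le_or_gt t (σ % N) with h | h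
        · obtain ⟨a, ha⟩ := Nat.exists_eq_add_of_le h
          rw [ha, iterate_symm_apply] at ht
          refine absurd ht (hσ2 a ?_)
          have := Nat.mod_le σ N
          omega
        · obtain ⟨a, ha⟩ := Nat.exists_eq_add_of_lt h
          rw [ha, add_assoc, iterate_add_symm_iterate] at ht
          exact Set.mem_biUnion (Finset.mem_coe.2 (Finset.mem_range.2 (by omega : a + 1 < N))) ht
      · left
        push Not at hv
        exact Set.mem_iInter.2 fun n i _ => hv i
    calc _ ≤ _ := measure_mono hsub
      _ ≤ μ (⋂ n, avoiding T.symm D n) + μ (⋃ r ∈ Finset.range N, T^[r] ⁻¹' D) :=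
        measure_union_le _ _
      _ ≤ 0 + ∑ r ∈ Finset.range N, μ (T^[r] ⁻¹' D) := by
        gcongr
        · exact (measure_never_visit hT.symm hD h0).le
        · exact measure_biUnion_finset_le _ _
      _ = _ := by
        rw [zero_add, Finset.sum_congr rfl fun r _ =>
          (hT.toMeasurePreserving.iterate r).measure_preimage hD.nullMeasurableSet]
        simp

/-- Rokhlin's lemma, with the base inside a large given set: among the levels of a tower, some one
has the least part outside that set, and can be used as a base. -/
theorem exists_isTowerBase_subset {μ : Measure X} [IsProbabilityMeasure μ] (hμ : IsNonatomic μ)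
    {T : X ≃ᵐ X} (hT : Ergodic T μ) {N : ℕ} (hN : 0 < N) {ε : ℝ≥0∞} (hε : 0 < ε) {G : Set X}
    (hG : MeasurableSet G) :
    ∃ E ⊆ G, MeasurableSet E ∧ IsTowerBase T E N ∧ μ (tower T E N)ᶜ ≤ ε + μ Gᶜ := by
  have hTm := hT.toMeasurePreserving
  obtain ⟨D, hD, hD0, hDε⟩ := hμ.exists_measure_lt (ε := ε / N)
    (ENNReal.div_pos hε.ne' (ENNReal.natCast_ne_top N))
  obtain ⟨E, hE, hbase, hmeas⟩ := exists_isTowerBase_of_visits hT hD hD0 hN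
  obtain ⟨s, hs, hmin⟩ := Finset.exists_min_image (Finset.range N)
    (fun s => μ (level T E s \ G)) ⟨0, Finset.mem_range.2 hN⟩
  have hbad : N * μ (level T E s \ G) ≤ μ Gᶜ := by
    have h1 := Finset.card_nsmul_le_sum (Finset.range N) (fun s => μ (level T E s \ G)) _ hmin
    rw [Finset.card_range, nsmul_eq_mul] at h1
    refine h1.trans ?_
    rw [← measure_biUnion_finset]
    · exact measure_mono (Set.iUnion₂_subset fun i _ x hx => hx.2)
    · intro i hi j hj hij
      exact (hbase i (by simpa using hi) j (by simpa using hj) hij).mono Set.sdiff_subset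
        Set.sdiff_subset
    · exact fun i _ => (measurableSet_level T hE i).diff hG
  have hlev : ∀ i, level T (level T E s) i = level T (level T E i) s := fun i => by
    simp only [level, ← Set.preimage_comp, ← Function.iterate_add, add_comm]
  refine ⟨level T E s ∩ G, Set.inter_subset_right, (measurableSet_level T hE s).inter hG, ?_, ?_⟩
  · intro i hi j hj hij
    have h1 : Disjoint (level T (level T E s) i) (level T (level T E s) j) := by
      rw [hlev, hlev]
      exact (hbase i hi j hj hij).preimage _
    exact h1.mono (Set.preimage_mono Set.inter_subset_left)
      (Set.preimage_mono Set.inter_subset_left)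
  · have hsub : (tower T (level T E s ∩ G) N)ᶜ ⊆ level T (tower T E N)ᶜ s ∪
        ⋃ i ∈ Finset.range N, level T (level T E s \ G) i := by
      intro x hx
      by_cases h : T.symm^[s] x ∈ tower T E N
      · right
        obtain ⟨i, hi, hxi⟩ := mem_tower.1 h
        refine Set.mem_biUnion (Finset.mem_coe.2 (Finset.mem_range.2 hi)) ⟨?_, fun hG' => ?_⟩
        · change T.symm^[s] (T.symm^[i] x) ∈ E
          rwa [← Function.iterate_add_apply, add_comm, Function.iterate_add_apply]
        · refine hx (mem_tower.2 ⟨i, hi, ?_, hG'⟩)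
          change T.symm^[s] (T.symm^[i] x) ∈ E
          rwa [← Function.iterate_add_apply, add_comm, Function.iterate_add_apply]
      · exact Or.inl h
    calc _ ≤ _ := measure_mono hsub
      _ ≤ μ (level T (tower T E N)ᶜ s) + μ (⋃ i ∈ Finset.range N, level T (level T E s \ G) i) :=
        measure_union_le _ _
      _ ≤ μ (level T (tower T E N)ᶜ s) + ∑ i ∈ Finset.range N, μ (level T (level T E s \ G) i) := by
        gcongr
        exact measure_biUnion_finset_le _ _
      _ = μ (tower T E N)ᶜ + N * μ (level T E s \ G) := by
        rw [measure_level hTm (measurableSet_tower T hE N).compl, Finset.sum_congr rfl fun i _ =>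
          measure_level hTm ((measurableSet_level T hE s).diff hG) i]
        simp
      _ ≤ ε + μ Gᶜ := by
        gcongr
        refine hmeas.trans ?_
        calc N * μ D ≤ N * (ε / N) := by gcongr
          _ ≤ ε := ENNReal.mul_div_le

/-! ### The averaged growth and its lowering by perturbation -/

/-- The integral of `log ‖A^n‖`. -/
noncomputable def growth (μ : Measure X) (T : X ≃ᵐ X) (A : X → SL(2, ℝ)) (n : ℕ) : ℝ :=
  ∫ x, Real.log (opNorm (iterFwd T A n x)) ∂μ

theorem log_opNorm_iterFwd_le {T : X ≃ᵐ X} {A : X → SL(2, ℝ)} {C : ℝ} {x : X}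
    (h : ∀ i, opNorm (A (T^[i] x)) ≤ C) (n : ℕ) :
    Real.log (opNorm (iterFwd T A n x)) ≤ n * Real.log C := by
  rw [← Real.log_pow, iterFwd_eq_seqProd]
  exact Real.log_le_log (opNorm_pos _) (opNorm_seqProd_le fun i _ => h i)

theorem measurable_log_opNorm {A : X → SL(2, ℝ)} (hA : StronglyMeasurable A) :
    Measurable fun x => Real.log (opNorm (A x)) :=
  Real.measurable_log.comp
    (Continuous.comp_stronglyMeasurable continuous_subtype_val hA).norm.measurable

theorem ae_forall_iterate {μ : Measure X} {T : X ≃ᵐ X} (hT : MeasurePreserving T μ μ)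
    {p : X → Prop} (h : ∀ᵐ x ∂μ, p x) : ∀ᵐ x ∂μ, ∀ i, p (T^[i] x) :=
  ae_all_iff.2 fun n => (hT.iterate n).quasiMeasurePreserving.ae h

theorem integrable_log_opNorm_iterFwd {μ : Measure X} [IsProbabilityMeasure μ] {T : X ≃ᵐ X}
    (hT : MeasurePreserving T μ μ) {A : X → SL(2, ℝ)} (hA : StronglyMeasurable A) {C : ℝ}
    (hC : ∀ᵐ x ∂μ, opNorm (A x) ≤ C) (n : ℕ) :
    Integrable (fun x => Real.log (opNorm (iterFwd T A n x))) μ := by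
  refine Integrable.of_bound
    (measurable_log_opNorm (stronglyMeasurable_iterFwd hA n)).aestronglyMeasurable
    (n * Real.log C) ?_
  filter_upwards [ae_forall_iterate hT hC] with x hx
  rw [Real.norm_eq_abs, abs_of_nonneg (log_opNorm_nonneg _)]
  exact log_opNorm_iterFwd_le hx n

/-- If the directions can be moved freely at the points of a set of positive measure, then along
most long orbit segments the product can be made small by small rotations. -/
theorem exists_measure_rotated_le {μ : Measure X} [IsProbabilityMeasure μ] {T : X ≃ᵐ X}
    (hT : Ergodic T μ) {A : X → SL(2, ℝ)} {C : ℝ} (hC : ∀ᵐ x ∂μ, opNorm (A x) ≤ C) {δ : ℝ}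
    (hδ : 0 ≤ δ) {Y : Set X} (hY : MeasurableSet Y) (hY0 : 0 < μ Y) {n : ℕ}
    (hreach : ∀ x ∈ Y, ∀ u w : Plane, u ≠ 0 → w ≠ 0 → Reach δ (orbitSeq T A x) n u w)
    {ε : ℝ} (hε : 0 < ε) {η : ℝ≥0∞} (hη : 0 < η) :
    ∃ N : ℕ, 0 < N ∧ μ {x | ¬ ∃ θ : ℕ → ℝ, (∀ i, |θ i| ≤ δ) ∧
      Real.log (opNorm (seqProd (rotated θ (orbitSeq T A x)) N)) < N * ε} ≤ η := by
  have hTm := hT.toMeasurePreserving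
  have hC1 : 1 ≤ C := by
    obtain ⟨x, hx⟩ := hC.exists
    exact (one_le_opNorm _).trans hx
  have hlogC : 0 ≤ Real.log C := Real.log_nonneg hC1
  -- `r` blocks of length `ℓ`, with `r` fixed and `ℓ` large
  obtain ⟨r, hr⟩ := exists_nat_ge ((4 * Real.log C + 1) / ε + 4)
  have hr4 : 4 ≤ r := by
    have : (4 : ℝ) ≤ r := le_trans (by have : 0 ≤ (4 * Real.log C + 1) / ε := by positivity
                                       linarith) hr
    exact_mod_cast this
  have hrε : 4 * Real.log C + 1 ≤ r * ε := by
    rw [← div_le_iff₀ hε]; linarith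
  have hlim : Tendsto (fun ℓ => (r : ℝ≥0∞) * μ (avoiding T Y ℓ)) atTop (𝓝 0) := by
    have := ENNReal.Tendsto.const_mul (tendsto_measure_avoiding hT hY hY0)
      (Or.inr (ENNReal.natCast_ne_top r))
    rwa [mul_zero] at this
  obtain ⟨ℓ₀, hℓ₀⟩ := exists_nat_gt (Real.log 2 + (n + 2) * Real.log C)
  obtain ⟨ℓ, hℓη, hℓ⟩ := ((hlim.eventually (gt_mem_nhds hη)).and (eventually_ge_atTop (ℓ₀ + 1))).exists
  have hℓ1 : 0 < ℓ := by omega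
  have hℓ' : Real.log 2 + (n + 2) * Real.log C < ℓ := by
    refine hℓ₀.trans_le ?_
    exact_mod_cast (by omega : ℓ₀ ≤ ℓ)
  refine ⟨n + r * ℓ, by positivity, ?_⟩
  have hsub : ∀ᵐ x ∂μ, (¬ ∃ θ : ℕ → ℝ, (∀ i, |θ i| ≤ δ) ∧
      Real.log (opNorm (seqProd (rotated θ (orbitSeq T A x)) (n + r * ℓ)))
        < ((n + r * ℓ : ℕ) : ℝ) * ε) →
      x ∈ ⋃ k ∈ Finset.range r, T^[k * ℓ] ⁻¹' avoiding T Y ℓ := by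
    filter_upwards [ae_forall_iterate hTm hC] with x hx hnot
    by_contra hvis
    apply hnot
    have hvis' : ∀ k < r, ∃ i < ℓ, T^[k * ℓ + i] x ∈ Y := by
      intro k hk
      by_contra! hcon
      refine hvis (Set.mem_biUnion (Finset.mem_coe.2 (Finset.mem_range.2 hk)) fun i hi => ?_)
      rw [← Function.iterate_add_apply, add_comm]
      exact hcon i hi
    obtain ⟨θ, hθ, hle⟩ := exists_rotated_opNorm_le hδ (A := orbitSeq T A x) hx (n := n)
      (m := r * ℓ) (L := 2 * ℓ) (by nlinarith) (fun j hj => by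
        -- a window of length `2ℓ` contains one of the blocks
        have h1 := Nat.div_add_mod (j + ℓ - 1) ℓ
        have h2 := Nat.mod_lt (j + ℓ - 1) hℓ1
        set k := (j + ℓ - 1) / ℓ
        have hk : k < r := by
          have h3 : ℓ * k < ℓ * r := by rw [mul_comm ℓ r]; omega
          exact lt_of_mul_lt_mul_left h3 (Nat.zero_le _)
        obtain ⟨i, hi, hiY⟩ := hvis' k hk
        refine ⟨k * ℓ + i, by rw [mul_comm k]; omega, by rw [mul_comm k]; omega, ?_⟩
        have := hreach _ hiY
        rwa [orbitSeq_iterate] at this)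
    refine ⟨θ, hθ, ?_⟩
    have h1 := Real.log_le_log (opNorm_pos _) hle
    rw [Real.log_mul two_ne_zero (by positivity), Real.log_pow] at h1
    refine h1.trans_lt ?_
    push_cast
    have h2 : (4 * Real.log C + 1) * ℓ ≤ r * ε * ℓ := by gcongr
    have h3 : 0 ≤ (n : ℝ) * ε := by positivity
    nlinarith
  calc _ ≤ μ (⋃ k ∈ Finset.range r, T^[k * ℓ] ⁻¹' avoiding T Y ℓ) := measure_mono_ae hsub
    _ ≤ ∑ k ∈ Finset.range r, μ (T^[k * ℓ] ⁻¹' avoiding T Y ℓ) := measure_biUnion_finset_le _ _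
    _ = r * μ (avoiding T Y ℓ) := by
      rw [Finset.sum_congr rfl fun k _ => (hTm.iterate (k * ℓ)).measure_preimage
        (measurableSet_avoiding T hY ℓ).nullMeasurableSet]
      simp
    _ ≤ η := hℓη.le

theorem continuous_log_opNorm_rotated (B : ℕ → SL(2, ℝ)) (N : ℕ) :
    Continuous fun θ : ℕ → ℝ => Real.log (opNorm (seqProd (rotated θ B) N)) := by
  have h : Continuous fun θ : ℕ → ℝ => seqProd (rotated θ B) N := by
    induction N with
    | zero => exact continuous_const
    | succ N ih =>
      exact ((continuous_rot.comp (continuous_apply N)).mul continuous_const).mul ih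
  exact (continuous_subtype_val.comp h).norm.log fun θ => (opNorm_pos _).ne'

theorem stronglyMeasurable_seqProd_rotated {T : X ≃ᵐ X} {A : X → SL(2, ℝ)}
    (hA : StronglyMeasurable A) (θ : ℕ → ℝ) (N : ℕ) :
    StronglyMeasurable fun x => seqProd (rotated θ (orbitSeq T A x)) N := by
  induction N with
  | zero => exact stronglyMeasurable_const
  | succ N ih =>
    exact (stronglyMeasurable_const.mul (hA.comp_measurable (T.measurable.iterate N))).mul ih

/-- The rotation angles that lower the norm of the product can be chosen measurably, among
countably many. -/
theorem exists_measurable_selection {T : X ≃ᵐ X} {A : X → SL(2, ℝ)} (hA : StronglyMeasurable A)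
    {δ : ℝ} (hδ : 0 ≤ δ) (N : ℕ) (c : ℝ) :
    MeasurableSet {x | ∃ θ : ℕ → ℝ, (∀ i, |θ i| ≤ δ) ∧
      Real.log (opNorm (seqProd (rotated θ (orbitSeq T A x)) N)) < c} ∧
    ∃ Θ : X → ℕ → ℝ, (∀ i, Measurable fun x => Θ x i) ∧ (∀ x i, |Θ x i| ≤ δ) ∧
      ∀ x, (∃ θ : ℕ → ℝ, (∀ i, |θ i| ≤ δ) ∧
        Real.log (opNorm (seqProd (rotated θ (orbitSeq T A x)) N)) < c) →
        Real.log (opNorm (seqProd (rotated (Θ x) (orbitSeq T A x)) N)) < c := by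
  classical
  have hne : Nonempty (ℕ → Set.Icc (-δ) δ) := ⟨fun _ => ⟨0, by simpa using hδ, hδ⟩⟩
  set d : ℕ → ℕ → ℝ := fun k i => (TopologicalSpace.denseSeq (ℕ → Set.Icc (-δ) δ) k i : ℝ) with hd
  have hdδ : ∀ k i, |d k i| ≤ δ := fun k i =>
    abs_le.2 (TopologicalSpace.denseSeq (ℕ → Set.Icc (-δ) δ) k i).2
  set G : ℕ → Set X := fun k =>
    {x | Real.log (opNorm (seqProd (rotated (d k) (orbitSeq T A x)) N)) < c} with hG
  have hGm : ∀ k, MeasurableSet (G k) := fun k =>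
    measurableSet_lt (measurable_log_opNorm (stronglyMeasurable_seqProd_rotated hA (d k) N))
      measurable_const
  have hex : ∀ x, (∃ θ : ℕ → ℝ, (∀ i, |θ i| ≤ δ) ∧
      Real.log (opNorm (seqProd (rotated θ (orbitSeq T A x)) N)) < c) ↔ ∃ k, x ∈ G k := by
    intro x
    constructor
    · rintro ⟨θ, hθ, hlt⟩
      have hcont : Continuous fun θ : ℕ → Set.Icc (-δ) δ =>
          Real.log (opNorm (seqProd (rotated (fun i => (θ i : ℝ)) (orbitSeq T A x)) N)) :=
        (continuous_log_opNorm_rotated (orbitSeq T A x) N).comp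
          (continuous_pi fun i => continuous_subtype_val.comp (continuous_apply i))
      obtain ⟨k, hk⟩ := (TopologicalSpace.denseRange_denseSeq (ℕ → Set.Icc (-δ) δ)).exists_mem_open
        (isOpen_lt hcont continuous_const) ⟨fun i => ⟨θ i, abs_le.1 (hθ i)⟩, hlt⟩
      exact ⟨k, hk⟩
    · rintro ⟨k, hk⟩
      exact ⟨d k, hdδ k, hk⟩
  have hset : {x | ∃ θ : ℕ → ℝ, (∀ i, |θ i| ≤ δ) ∧
      Real.log (opNorm (seqProd (rotated θ (orbitSeq T A x)) N)) < c} = ⋃ k, G k := by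
    ext x; rw [Set.mem_iUnion]; exact hex x
  have hmeas : MeasurableSet (⋃ k, G k) := MeasurableSet.iUnion hGm
  refine ⟨hset ▸ hmeas, ?_⟩
  have hall : ∀ x, ∃ k, x ∈ (⋃ k, G k)ᶜ ∪ G k := by
    intro x
    by_cases h : x ∈ ⋃ k, G k
    · obtain ⟨k, hk⟩ := Set.mem_iUnion.1 h
      exact ⟨k, Or.inr hk⟩
    · exact ⟨0, Or.inl h⟩
  have hfind : Measurable fun x => Nat.find (hall x) :=
    measurable_find hall fun k => hmeas.compl.union (hGm k)
  refine ⟨fun x => d (Nat.find (hall x)), fun i => ?_, fun x i => hdδ _ _, fun x hx => ?_⟩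
  · exact (measurable_from_nat (f := fun k => d k i)).comp hfind
  · rcases Nat.find_spec (hall x) with h | h
    · exact absurd (Set.mem_iUnion.2 ((hex x).1 hx)) h
    · exact h

/-- The norm of a product along an orbit that goes through towers: each passage through a tower
costs `N * ε` and each step outside costs `log C`, up to a bounded error at the two ends. -/
theorem log_opNorm_iterFwd_le_of_tower {T : X ≃ᵐ X} {B : X → SL(2, ℝ)} {E : Set X} {N : ℕ}
    (hbase : IsTowerBase T E N) {C ε : ℝ} (hC : 1 ≤ C) (hε : 0 ≤ ε)
    (hE : ∀ x ∈ E, Real.log (opNorm (iterFwd T B N x)) ≤ N * ε) {x : X}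
    (hx : ∀ i, opNorm (B (T^[i] x)) ≤ C) (n : ℕ) :
    Real.log (opNorm (iterFwd T B n x)) ≤ ∑ i ∈ Finset.range n,
      (ε + Set.indicator (tower T E N)ᶜ (fun _ => Real.log C) (T^[i] x))
        + 2 * (N * Real.log C) := by
  have hlogC : 0 ≤ Real.log C := Real.log_nonneg hC
  set c : X → ℝ := fun x => ε + Set.indicator (tower T E N)ᶜ (fun _ => Real.log C) x with hc
  have hc0 : ∀ x, 0 ≤ c x := fun x =>
    add_nonneg hε (Set.indicator_nonneg (fun _ _ => hlogC) _)
  have hcε : ∀ x, ε ≤ c x := fun x =>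
    le_add_of_nonneg_right (Set.indicator_nonneg (fun _ _ => hlogC) _)
  have hcC : ∀ x ∉ tower T E N, Real.log C ≤ c x := fun x hx => by
    simp only [hc]
    rw [Set.indicator_of_mem (by exact hx : x ∈ (tower T E N)ᶜ)]
    linarith
  have hsplit : ∀ (x : X) (a b : ℕ), ∑ i ∈ Finset.range (a + b), c (T^[i] x)
      = ∑ i ∈ Finset.range a, c (T^[i] x) + ∑ i ∈ Finset.range b, c (T^[i] (T^[a] x)) := by
    intro x a b
    rw [Finset.sum_range_add]
    congr 1
    refine Finset.sum_congr rfl fun i _ => ?_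
    rw [← Function.iterate_add_apply, add_comm]
  have hlog : ∀ (x : X) (a b : ℕ), Real.log (opNorm (iterFwd T B (a + b) x)) ≤
      Real.log (opNorm (iterFwd T B a x)) + Real.log (opNorm (iterFwd T B b (T^[a] x))) := by
    intro x a b
    rw [iterFwd_add, add_comm]
    exact log_opNorm_mul_le _ _
  have hbd : ∀ {x : X}, (∀ i, opNorm (B (T^[i] x)) ≤ C) → ∀ a i,
      opNorm (B (T^[i] (T^[a] x))) ≤ C := fun h a i => by
    rw [← Function.iterate_add_apply]; exact h _
  have hsum0 : ∀ (x : X) (n : ℕ), 0 ≤ ∑ i ∈ Finset.range n, c (T^[i] x) := fun x n =>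
    Finset.sum_nonneg fun i _ => hc0 _
  -- the step after the end of a passage is not in the middle of another one
  have hout : ∀ y, y ∉ tower T E N → T y ∈ E ∨ T y ∉ tower T E N := by
    intro y hy
    by_contra! hcon
    obtain ⟨i, hi, hiE⟩ := mem_tower.1 hcon.2
    rcases Nat.eq_zero_or_pos i with rfl | h
    · exact hcon.1 hiE
    · obtain ⟨j, rfl⟩ := Nat.exists_eq_add_of_le' h
      rw [Function.iterate_succ_apply, T.symm_apply_apply] at hiE
      exact hy (mem_tower.2 ⟨j, by omega, hiE⟩)
  have htop : ∀ y ∈ E, T^[N] y ∈ E ∨ T^[N] y ∉ tower T E N := by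
    intro y hy
    by_contra! hcon
    obtain ⟨i, hi, hiE⟩ := mem_tower.1 hcon.2
    rcases Nat.eq_zero_or_pos i with rfl | h
    · exact hcon.1 hiE
    · have h1 : T^[N - 1] y ∈ level T E (i - 1) := by
        change T.symm^[i - 1] (T^[N - 1] y) ∈ E
        have e1 := symm_iterate_iterate T (i - 1) (N - i) y
        have e2 := symm_iterate_iterate T i (N - i) y
        rw [show i - 1 + (N - i) = N - 1 by omega] at e1
        rw [show i + (N - i) = N by omega] at e2
        rwa [e1, ← e2]
      have h2 : T^[N - 1] y ∈ level T E (N - 1) := by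
        change T.symm^[N - 1] (T^[N - 1] y) ∈ E
        have e := symm_iterate_iterate T (N - 1) 0 y
        rw [add_zero] at e
        rw [e]
        exact hy
      exact Set.disjoint_left.1 (hbase (i - 1) (by omega) (N - 1) (by omega) (by omega)) h1 h2
  have hstart : ∀ n x, (∀ i, opNorm (B (T^[i] x)) ≤ C) → (x ∈ E ∨ x ∉ tower T E N) →
      Real.log (opNorm (iterFwd T B n x)) ≤
        ∑ i ∈ Finset.range n, c (T^[i] x) + N * Real.log C := by
    intro n
    induction n using Nat.strong_induction_on with
    | _ n ih =>
      intro x hx hxs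
      have hshort : n ≤ N → Real.log (opNorm (iterFwd T B n x)) ≤
          ∑ i ∈ Finset.range n, c (T^[i] x) + N * Real.log C := by
        intro hn
        have h1 := log_opNorm_iterFwd_le hx n
        have h2 : (n : ℝ) * Real.log C ≤ N * Real.log C := by gcongr
        linarith [hsum0 x n]
      rcases Nat.eq_zero_or_pos n with rfl | hn
      · exact hshort (Nat.zero_le _)
      rcases Nat.eq_zero_or_pos N with hN0 | hN
      · have hxt : x ∉ tower T E N := fun h => by
          obtain ⟨i, hi, -⟩ := mem_tower.1 h; omega
        obtain ⟨m, rfl⟩ := Nat.exists_eq_add_of_le hn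
        have h1 := hlog x 1 m
        have h2 := ih m (by omega) (T^[1] x) (hbd hx 1) (hout x hxt)
        have h3 := log_opNorm_iterFwd_le hx 1
        have h4 := hcC x hxt
        rw [hsplit, Finset.sum_range_one, Function.iterate_zero_apply]
        push_cast at h3
        linarith
      by_cases hxt : x ∈ tower T E N
      · have hxE : x ∈ E := hxs.resolve_right (not_not.2 hxt)
        rcases le_or_gt n N with hnN | hnN
        · exact hshort hnN
        · obtain ⟨m, rfl⟩ := Nat.exists_eq_add_of_le hnN.le
          have h1 := hlog x N m
          have h2 := ih m (by omega) (T^[N] x) (hbd hx N) (htop x hxE)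
          have h3 := hE x hxE
          have h4 : N * ε ≤ ∑ i ∈ Finset.range N, c (T^[i] x) := by
            have := Finset.card_nsmul_le_sum (Finset.range N) (fun i => c (T^[i] x)) ε
              fun i _ => hcε _
            rwa [Finset.card_range, nsmul_eq_mul] at this
          rw [hsplit]
          linarith
      · obtain ⟨m, rfl⟩ := Nat.exists_eq_add_of_le hn
        have h1 := hlog x 1 m
        have h2 := ih m (by omega) (T^[1] x) (hbd hx 1) (hout x hxt)
        have h3 := log_opNorm_iterFwd_le hx 1
        have h4 := hcC x hxt
        rw [hsplit, Finset.sum_range_one, Function.iterate_zero_apply]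
        push_cast at h3
        linarith
  change Real.log (opNorm (iterFwd T B n x)) ≤ ∑ i ∈ Finset.range n, c (T^[i] x) + _
  have hNC : 0 ≤ N * Real.log C := by positivity
  by_cases hxt : x ∈ tower T E N
  · obtain ⟨i, hi, hiE⟩ := mem_tower.1 hxt
    rcases le_or_gt n (N - i) with hn | hn
    · have h1 := log_opNorm_iterFwd_le hx n
      have h2 : (n : ℝ) * Real.log C ≤ N * Real.log C := by gcongr; omega
      linarith [hsum0 x n]
    · obtain ⟨m, rfl⟩ := Nat.exists_eq_add_of_le hn.le
      have h1 := hlog x (N - i) m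
      have hend : T^[N - i] x ∈ E ∨ T^[N - i] x ∉ tower T E N := by
        have := iterate_add_symm_iterate T i (N - i) x
        rw [Nat.add_sub_cancel' hi.le] at this
        rw [← this]
        exact htop _ hiE
      have h2 := hstart m _ (hbd hx (N - i)) hend
      have h3 := log_opNorm_iterFwd_le hx (N - i)
      have h4 : ((N - i : ℕ) : ℝ) * Real.log C ≤ N * Real.log C := by gcongr; omega
      rw [hsplit]
      linarith [hsum0 x (N - i)]
  · have := hstart n x hx (Or.inr hxt)
    linarith

theorem integral_comp_measurePreserving {μ : Measure X} {f : X → X}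
    (hf : MeasurePreserving f μ μ) {g : X → ℝ} (hg : AEStronglyMeasurable g μ) :
    ∫ x, g (f x) ∂μ = ∫ x, g x ∂μ := by
  have h := integral_map hf.measurable.aemeasurable (hf.map_eq.symm ▸ hg)
  rw [hf.map_eq] at h
  exact h.symm

theorem growth_le_of_tower {μ : Measure X} [IsProbabilityMeasure μ] {T : X ≃ᵐ X}
    (hT : MeasurePreserving T μ μ) {B : X → SL(2, ℝ)} (hB : StronglyMeasurable B) {E : Set X}
    (hEm : MeasurableSet E) {N : ℕ}
    (hbase : IsTowerBase T E N) {C ε : ℝ} (hC : 1 ≤ C) (hε : 0 ≤ ε)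
    (hE : ∀ x ∈ E, Real.log (opNorm (iterFwd T B N x)) ≤ N * ε)
    (hBC : ∀ᵐ x ∂μ, opNorm (B x) ≤ C) (n : ℕ) :
    growth μ T B n ≤ n * (ε + Real.log C * μ.real (tower T E N)ᶜ) + 2 * (N * Real.log C) := by
  have hUm := (measurableSet_tower T hEm N).compl
  set c : X → ℝ := fun x => ε + Set.indicator (tower T E N)ᶜ (fun _ => Real.log C) x with hc
  have hci : Integrable c μ := (integrable_const ε).add ((integrable_const _).indicator hUm)
  have hcT : ∀ i, Integrable (fun x => c (T^[i] x)) μ := fun i =>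
    (hT.iterate i).integrable_comp_of_integrable hci
  have hint : ∀ i, ∫ x, c (T^[i] x) ∂μ = ε + Real.log C * μ.real (tower T E N)ᶜ := by
    intro i
    rw [integral_comp_measurePreserving (hT.iterate i) hci.aestronglyMeasurable,
      integral_add (integrable_const _) ((integrable_const _).indicator hUm),
      integral_indicator_const _ hUm]
    simp [mul_comm]
  calc growth μ T B n
      ≤ ∫ x, (∑ i ∈ Finset.range n, c (T^[i] x) + 2 * (N * Real.log C)) ∂μ := by
        refine integral_mono_ae (integrable_log_opNorm_iterFwd hT hB hBC n)
          ((integrable_finsetSum _ fun i _ => hcT i).add (integrable_const _)) ?_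
        filter_upwards [ae_forall_iterate hT hBC] with x hx
        exact log_opNorm_iterFwd_le_of_tower hbase hC hε hE hx n
    _ = _ := by
        rw [integral_add (integrable_finsetSum _ fun i _ => hcT i) (integrable_const _),
          integral_finsetSum _ fun i _ => hcT i, Finset.sum_congr rfl fun i _ => hint i]
        simp only [Finset.sum_const, Finset.card_range, nsmul_eq_mul, integral_const, probReal_univ,
          one_smul]

theorem LinftySL.stronglyMeasurable {μ : Measure X} (A : LinftySL μ) :
    StronglyMeasurable (A : X → SL(2, ℝ)) := A.toAEEqFun.stronglyMeasurable

theorem LinftySL.exists_opNorm_le {μ : Measure X} (A : LinftySL μ) :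
    ∃ C : ℝ, 1 ≤ C ∧ ∀ᵐ x ∂μ, opNorm (A x) ≤ C := by
  obtain ⟨C, hC⟩ := A.ess_bounded
  exact ⟨max 1 C, le_max_left _ _, hC.mono fun x hx => hx.trans (le_max_right _ _)⟩

theorem growth_congr {μ : Measure X} {T : X ≃ᵐ X} (hT : MeasurePreserving T μ μ)
    {A B : X → SL(2, ℝ)} (h : ∀ᵐ x ∂μ, A x = B x) (n : ℕ) : growth μ T A n = growth μ T B n := by
  refine integral_congr_ae ?_
  filter_upwards [ae_forall_iterate hT h] with x hx
  rw [iterFwd_eq_seqProd, iterFwd_eq_seqProd,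
    seqProd_congr (B := orbitSeq T A x) (B' := orbitSeq T B x) fun i _ => hx i]

/-- The perturbation rotates along the columns of a tower that fills most of the space and whose
base consists of points where the product over the height of the tower can be made small. -/
theorem exists_perturbation_growth_lt {μ : Measure X} [IsProbabilityMeasure μ]
    (hμ : IsNonatomic μ) {T : X ≃ᵐ X} (hT : Ergodic T μ) (A : LinftySL μ) {C : ℝ} (hC : 1 ≤ C)
    (hAC : ∀ᵐ x ∂μ, opNorm (A x) ≤ C) {δ : ℝ} (hδ : 0 ≤ δ) {Y : Set X} (hY : MeasurableSet Y)
    (hY0 : 0 < μ Y) {k : ℕ}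
    (hreach : ∀ x ∈ Y, ∀ u w : Plane, u ≠ 0 → w ≠ 0 → Reach δ (orbitSeq T A x) k u w)
    {ε : ℝ} (hε : 0 < ε) :
    ∃ B : LinftySL μ, dist A B ≤ δ * C ∧ ∃ n : ℕ, 0 < n ∧ growth μ T B n < n * ε := by
  have hTm := hT.toMeasurePreserving
  have hA := A.stronglyMeasurable
  have hlogC : 0 ≤ Real.log C := Real.log_nonneg hC
  set η : ℝ := ε / (8 * (Real.log C + 1)) with hη
  have hη0 : 0 < η := by positivity
  obtain ⟨N, hN, hGN⟩ := exists_measure_rotated_le hT hAC hδ hY hY0 hreach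
    (ε := ε / 4) (by positivity) (η := ENNReal.ofReal η) (by simpa using hη0)
  obtain ⟨hGm, Θ, hΘm, hΘδ, hΘ⟩ := exists_measurable_selection (T := T) hA hδ N (N * (ε / 4))
  set G := {x | ∃ θ : ℕ → ℝ, (∀ i, |θ i| ≤ δ) ∧
      Real.log (opNorm (seqProd (rotated θ (orbitSeq T A x)) N)) < N * (ε / 4)} with hG
  have hGc : μ Gᶜ ≤ ENNReal.ofReal η := hGN
  obtain ⟨E, hEG, hE, hbase, htower⟩ := exists_isTowerBase_subset hμ hT hN
    (ε := ENNReal.ofReal η) (by simpa using hη0) hGm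
  have htower' : μ.real (tower T E N)ᶜ ≤ 2 * η := by
    refine ENNReal.toReal_le_of_le_ofReal (by positivity) (htower.trans ?_)
    rw [two_mul, ENNReal.ofReal_add hη0.le hη0.le]
    gcongr
  -- the rotation angle at each point
  set φ : X → ℝ := fun x => ∑ i ∈ Finset.range N,
    Set.indicator (level T E i) (fun x => Θ (T.symm^[i] x) i) x with hφ
  have hφm : Measurable φ := Finset.measurable_sum _ fun i _ =>
    ((hΘm i).comp (T.symm.measurable.iterate i)).indicator (measurableSet_level T hE i)
  have hφi : ∀ i < N, ∀ x ∈ level T E i, φ x = Θ (T.symm^[i] x) i := by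
    intro i hi x hx
    rw [hφ]
    dsimp only
    rw [Finset.sum_eq_single i, Set.indicator_of_mem hx]
    · intro j hj hji
      refine Set.indicator_of_notMem (fun hxj => ?_) _
      exact Set.disjoint_left.1 (hbase i hi j (Finset.mem_range.1 hj) hji.symm) hx hxj
    · exact fun h => absurd (Finset.mem_range.2 hi) h
  have hφδ : ∀ x, |φ x| ≤ δ := by
    intro x
    by_cases hx : x ∈ tower T E N
    · obtain ⟨i, hi, hxi⟩ := mem_tower.1 hx
      rw [hφi i hi x hxi]
      exact hΘδ _ _
    · have : φ x = 0 := Finset.sum_eq_zero fun i hi =>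
        Set.indicator_of_notMem (s := level T E i)
          (fun h => hx (mem_tower.2 ⟨i, Finset.mem_range.1 hi, h⟩)) _
      rw [this, abs_zero]
      exact hδ
  set B₀ : X → SL(2, ℝ) := fun x => rot (φ x) * A x with hB₀
  have hB₀m : StronglyMeasurable B₀ :=
    (continuous_rot.comp_stronglyMeasurable hφm.stronglyMeasurable).mul hA
  have hB₀C : ∀ᵐ x ∂μ, opNorm (B₀ x) ≤ C :=
    hAC.mono fun x hx => (opNorm_rot_mul_le _ _).trans hx
  have hBae := AEEqFun.coeFn_mk B₀ (hB₀m.aestronglyMeasurable (μ := μ))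
  let B : LinftySL μ := ⟨AEEqFun.mk B₀ hB₀m.aestronglyMeasurable, C, by
    filter_upwards [hBae, hB₀C] with x h1 h2
    rw [h1]; exact h2⟩
  have hBB : ∀ᵐ x ∂μ, B x = B₀ x := hBae
  refine ⟨B, ?_, ?_⟩
  · rw [LinftySL.dist_def]
    refine ENNReal.toReal_le_of_le_ofReal (by positivity) (eLpNormEssSup_le_of_ae_bound ?_)
    filter_upwards [hBB, hAC] with x h1 h2
    rw [h1, norm_sub_rev]
    have e : ((B₀ x : SL(2, ℝ)) : Matrix (Fin 2) (Fin 2) ℝ) - (A x : Matrix (Fin 2) (Fin 2) ℝ)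
        = ((rot (φ x) : Matrix (Fin 2) (Fin 2) ℝ) - 1) * (A x : Matrix (Fin 2) (Fin 2) ℝ) := by
      rw [sub_mul, one_mul]; rfl
    rw [e]
    refine (Matrix.l2_opNorm_mul _ _).trans ?_
    exact mul_le_mul ((norm_rot_sub_one_le _).trans (hφδ x)) h2 (norm_nonneg _) hδ
  · obtain ⟨n, hn⟩ := exists_nat_gt (2 * (N * Real.log C) / (ε / 2))
    have hn0 : (0 : ℝ) < n := lt_of_le_of_lt (by positivity) hn
    refine ⟨n, by exact_mod_cast hn0, ?_⟩
    rw [growth_congr hTm hBB]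
    have hEB : ∀ x ∈ E, Real.log (opNorm (iterFwd T B₀ N x)) ≤ N * (ε / 4) := by
      intro x hx
      have h1 := hΘ x (hEG hx)
      rw [iterFwd_eq_seqProd, seqProd_congr (B' := rotated (Θ x) (orbitSeq T A x))]
      · exact h1.le
      · intro i hi
        have e : T.symm^[i] (T^[i] x) = x := symm_iterate_iterate T i 0 x
        have h2 := hφi i hi (T^[i] x) (by change T.symm^[i] (T^[i] x) ∈ E; rwa [e])
        rw [e] at h2
        simp only [orbitSeq, hB₀, rotated, h2]
    have h1 := growth_le_of_tower hTm hB₀m hE hbase hC (by positivity) hEB hB₀C n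
    refine h1.trans_lt ?_
    rw [div_lt_iff₀ (by positivity)] at hn
    have h2 : Real.log C * μ.real (tower T E N)ᶜ ≤ ε / 4 := by
      calc Real.log C * μ.real (tower T E N)ᶜ ≤ (Real.log C + 1) * (2 * η) := by
            gcongr; linarith
        _ = ε / 4 := by rw [hη]; field_simp; ring
    have h3 : (n : ℝ) * (ε / 4 + Real.log C * μ.real (tower T E N)ᶜ) ≤ n * (ε / 4 + ε / 4) := by
      gcongr
    linarith

/-- A cocycle that is not uniformly hyperbolic is approximated by cocycles of small growth. -/
theorem exists_dist_lt_growth_lt {μ : Measure X} [IsProbabilityMeasure μ]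
    (hμ : IsNonatomic μ) {T : X ≃ᵐ X} (hT : Ergodic T μ) (A : LinftySL μ)
    (hA : ¬ IsUniformlyHyperbolic μ T A) {r : ℝ} (hr : 0 < r) {ε : ℝ} (hε : 0 < ε) :
    ∃ B : LinftySL μ, dist A B < r ∧ ∃ n : ℕ, 0 < n ∧ growth μ T B n < n * ε := by
  have hTm := hT.toMeasurePreserving
  have hAm := A.stronglyMeasurable
  obtain ⟨C, hC, hAC⟩ := A.exists_opNorm_le
  obtain ⟨δ, hδ0, hδ⟩ : ∃ δ : ℝ, 0 < δ ∧ δ < min (Real.pi / 4) (r / C) :=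
    exists_between (by have := Real.pi_pos; positivity)
  rw [lt_min_iff, lt_div_iff₀ (by positivity : 0 < C)] at hδ
  obtain ⟨K, hK, hdich⟩ := sum_norm_sq_le_of_not_reach hδ0 hδ.1 C
  set W : ℕ → Set X := fun n => {x | ∀ v : Plane,
    ∑ i ∈ Finset.range n, ‖act (iterFwd T A i x) v‖ ^ 2
      ≤ K * (‖v‖ ^ 2 + ‖act (iterFwd T A n x) v‖ ^ 2)} with hW
  have hWm : ∀ n, MeasurableSet (W n) := by
    intro n
    have hset : W n = ⋂ j : ℕ, {x | ∑ i ∈ Finset.range n,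
        ‖act (iterFwd T A i x) (TopologicalSpace.denseSeq Plane j)‖ ^ 2
          ≤ K * (‖TopologicalSpace.denseSeq Plane j‖ ^ 2
            + ‖act (iterFwd T A n x) (TopologicalSpace.denseSeq Plane j)‖ ^ 2)} := by
      ext x
      rw [Set.mem_iInter]
      refine ⟨fun h j => h _, fun h v => ?_⟩
      have hcl : IsClosed {v : Plane | ∑ i ∈ Finset.range n, ‖act (iterFwd T A i x) v‖ ^ 2
          ≤ K * (‖v‖ ^ 2 + ‖act (iterFwd T A n x) v‖ ^ 2)} :=
        isClosed_le (continuous_finsetSum _ fun i _ => (continuous_act _).norm.pow 2)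
          (continuous_const.mul ((continuous_norm.pow 2).add ((continuous_act _).norm.pow 2)))
      exact (TopologicalSpace.denseRange_denseSeq Plane).induction_on
        (p := fun v => ∑ i ∈ Finset.range n, ‖act (iterFwd T A i x) v‖ ^ 2
          ≤ K * (‖v‖ ^ 2 + ‖act (iterFwd T A n x) v‖ ^ 2)) v hcl h
    rw [hset]
    have hm : ∀ i v, Measurable fun x => ‖act (iterFwd T A i x) v‖ ^ 2 := fun i v => by
      simp only [norm_sq_plane]
      exact ((measurable_act (stronglyMeasurable_iterFwd hAm i) v 0).pow_const 2).add
        ((measurable_act (stronglyMeasurable_iterFwd hAm i) v 1).pow_const 2)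
    exact MeasurableSet.iInter fun j => measurableSet_le
      (Finset.measurable_sum _ fun i _ => hm i _) (((hm n _).const_add _).const_mul _)
  by_cases hall : ∀ n, μ (W n)ᶜ = 0
  · refine absurd (isUniformlyHyperbolic_of_endControl hTm hAm hK ?_) hA
    have h1 : ∀ᵐ x ∂μ, ∀ n, x ∈ W n := ae_all_iff.2 fun n => hall n
    filter_upwards [h1] with x hx n v
    simpa only [iterFwd_eq_seqProd] using hx n v
  push Not at hall
  obtain ⟨n, hn⟩ := hall
  have hbd : MeasurableSet {x | ∀ i, opNorm (A (T^[i] x)) ≤ C} := by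
    rw [Set.ofPred_forall]
    exact MeasurableSet.iInter fun i => measurableSet_le
      (Continuous.comp_stronglyMeasurable continuous_subtype_val
        (hAm.comp_measurable (T.measurable.iterate i))).norm.measurable measurable_const
  have hY0 : 0 < μ (T ⁻¹' (W n)ᶜ ∩ {x | ∀ i, opNorm (A (T^[i] x)) ≤ C}) := by
    rw [measure_inter_conull]
    · rw [hTm.measure_preimage (hWm n).compl.nullMeasurableSet]
      exact pos_iff_ne_zero.2 hn
    · exact (ae_forall_iterate hTm hAC)
  obtain ⟨B, hB, hgrowth⟩ := exists_perturbation_growth_lt hμ hT A hC hAC hδ0.le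
    (((T.measurable (hWm n).compl)).inter hbd) hY0 (k := n + 2) (fun x hx u w hu hw => by
      by_contra hcon
      refine hx.1 fun v => ?_
      have h1 := hdich (orbitSeq T A x) n hx.2 u w hu hw hcon v
      have h2 := orbitSeq_iterate T A 1 x
      rw [← h2, Function.iterate_one] at h1
      simpa only [iterFwd_eq_seqProd] using h1) hε
  exact ⟨B, hB.trans_lt hδ.2, hgrowth⟩

/-! ### The maximal inequality and vanishing exponents -/

/-- The maximum of the Birkhoff sums of `f` of length at most `n`, including the empty sum. -/
noncomputable def maxBirkhoff {Y : Type*} (S : Y → Y) (f : Y → ℝ) : ℕ → Y → ℝ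
  | 0, _ => 0
  | n + 1, x => max 0 (f x + maxBirkhoff S f n (S x))

theorem maxBirkhoff_nonneg {Y : Type*} (S : Y → Y) (f : Y → ℝ) (n : ℕ) (x : Y) : 0 ≤ maxBirkhoff S f n x := by
  cases n with
  | zero => exact le_rfl
  | succ n => exact le_max_left _ _

theorem maxBirkhoff_le_succ {Y : Type*} (S : Y → Y) (f : Y → ℝ) (n : ℕ) (x : Y) :
    maxBirkhoff S f n x ≤ maxBirkhoff S f (n + 1) x := by
  induction n generalizing x with
  | zero => exact maxBirkhoff_nonneg S f 1 x
  | succ n ih => exact max_le_max le_rfl (add_le_add le_rfl (ih (S x)))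

theorem birkhoffSum_le_maxBirkhoff {Y : Type*} (S : Y → Y) (f : Y → ℝ) (n : ℕ) (x : Y) :
    birkhoffSum S f n x ≤ maxBirkhoff S f n x := by
  induction n generalizing x with
  | zero => simp [maxBirkhoff]
  | succ n ih =>
    rw [birkhoffSum_succ']
    exact le_max_of_le_right (add_le_add le_rfl (ih (S x)))

theorem integrable_maxBirkhoff {μ : Measure X} {S : X → X}
    (hS : MeasurePreserving S μ μ) {f : X → ℝ} (hf : Integrable f μ) (n : ℕ) :
    Integrable (maxBirkhoff S f n) μ := by
  induction n with
  | zero => exact integrable_zero _ _ _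
  | succ n ih =>
    exact (integrable_zero _ _ _).sup (hf.add (hS.integrable_comp_of_integrable ih))

theorem measurable_maxBirkhoff {S : X → X} (hS : Measurable S) {f : X → ℝ} (hf : Measurable f)
    (n : ℕ) : Measurable (maxBirkhoff S f n) := by
  induction n with
  | zero => exact measurable_const
  | succ n ih => exact measurable_const.max (hf.add (ih.comp hS))

/-- The maximal ergodic inequality for nonnegative functions. -/
theorem measure_exists_lt_birkhoffSum_le {μ : Measure X} [IsProbabilityMeasure μ] {S : X → X}
    (hS : MeasurePreserving S μ μ) {g : X → ℝ} (hg : Measurable g) (hgi : Integrable g μ)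
    (hg0 : ∀ x, 0 ≤ g x) {α : ℝ} (hα : 0 < α) :
    μ {x | ∃ k : ℕ, k * α < birkhoffSum S g k x} ≤ ENNReal.ofReal ((∫ x, g x ∂μ) / α) := by
  set f : X → ℝ := fun x => g x - α with hf
  have hfi : Integrable f μ := hgi.sub (integrable_const _)
  have hfm : Measurable f := hg.sub_const _
  set M := maxBirkhoff S f with hM
  have hpos : ∀ n, MeasurableSet {x | 0 < M n x} := fun n =>
    measurableSet_lt measurable_const (measurable_maxBirkhoff hS.measurable hfm n)
  have hbound : ∀ n, μ {x | 0 < M n x} ≤ ENNReal.ofReal ((∫ x, g x ∂μ) / α) := by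
    intro n
    rw [← ofReal_measureReal]
    apply ENNReal.ofReal_le_ofReal
    rw [le_div_iff₀ hα]
    have hMi : Integrable (M n) μ := integrable_maxBirkhoff hS hfi n
    have hMS : Integrable (fun x => M n (S x)) μ := hS.integrable_comp_of_integrable hMi
    have h1 : ∫ x, (M n x - M n (S x)) ∂μ
        ≤ ∫ x, Set.indicator {x | 0 < M n x} (fun x => g x - α) x ∂μ := by
      refine integral_mono (hMi.sub hMS) (hfi.indicator (hpos n)) fun x => ?_
      have h0 := maxBirkhoff_nonneg S f n (S x)
      by_cases hx : 0 < M n x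
      · rw [Set.indicator_of_mem (by exact hx : x ∈ {x | 0 < M n x})]
        cases n with
        | zero => exact absurd hx (lt_irrefl 0)
        | succ n =>
          have h2 : M (n + 1) x = f x + M n (S x) := by
            have : 0 < max 0 (f x + M n (S x)) := hx
            rcases lt_max_iff.1 this with h | h
            · exact absurd h (lt_irrefl 0)
            · exact max_eq_right h.le
          have h3 := maxBirkhoff_le_succ S f n (S x)
          change M (n + 1) x - M (n + 1) (S x) ≤ f x
          rw [h2]
          linarith
      · rw [Set.indicator_of_notMem (by exact hx : x ∉ {x | 0 < M n x})]
        change M n x - M n (S x) ≤ 0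
        linarith [not_lt.1 hx]
    rw [integral_sub hMi hMS, integral_comp_measurePreserving hS hMi.aestronglyMeasurable,
      sub_self, integral_indicator (hpos n), integral_sub hgi.integrableOn
        (integrable_const _).integrableOn, setIntegral_const, smul_eq_mul] at h1
    have h2 := setIntegral_le_integral (s := {x | 0 < M n x}) hgi (Eventually.of_forall hg0)
    linarith
  have hsub : {x | ∃ k : ℕ, k * α < birkhoffSum S g k x} ⊆ ⋃ n, {x | 0 < M n x} := by
    rintro x ⟨k, hk⟩
    refine Set.mem_iUnion.2 ⟨k, ?_⟩
    refine lt_of_lt_of_le ?_ (birkhoffSum_le_maxBirkhoff S f k x)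
    have : birkhoffSum S f k x = birkhoffSum S g k x - k * α := by
      simp [birkhoffSum, hf, Finset.sum_sub_distrib]
    rw [this]
    linarith
  have hmono : Monotone fun n => {x | 0 < M n x} :=
    monotone_nat_of_le_succ fun n x hx => lt_of_lt_of_le hx (maxBirkhoff_le_succ S f n x)
  refine (measure_mono hsub).trans ?_
  rw [hmono.measure_iUnion]
  exact iSup_le hbound

theorem log_opNorm_iterFwd_mul_le (T : X ≃ᵐ X) (A : X → SL(2, ℝ)) (N k : ℕ) (x : X) :
    Real.log (opNorm (iterFwd T A (N * k) x))
      ≤ birkhoffSum (T^[N]) (fun x => Real.log (opNorm (iterFwd T A N x))) k x := by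
  induction k with
  | zero => simp [iterFwd, opNorm]
  | succ k ih =>
    rw [birkhoffSum_succ, Nat.mul_succ, iterFwd_add, ← Function.iterate_mul]
    have := log_opNorm_mul_le (iterFwd T A N (T^[N * k] x)) (iterFwd T A (N * k) x)
    linarith

/-- If the averages of `log ‖A^n‖` are arbitrarily close to zero, the exponent vanishes. The maximal
inequality is used for `T^N` and `log ‖A^N‖`, whose Birkhoff sums dominate `log ‖A^{Nk}‖`. -/
theorem hasLE_zero_of_growth_lt {μ : Measure X} [IsProbabilityMeasure μ] {T : X ≃ᵐ X}
    (hT : MeasurePreserving T μ μ) {A : X → SL(2, ℝ)} (hA : StronglyMeasurable A) {C : ℝ}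
    (hC : ∀ᵐ x ∂μ, opNorm (A x) ≤ C) (h : ∀ ε > 0, ∃ n : ℕ, 0 < n ∧ growth μ T A n < n * ε) :
    HasLE μ T A 0 := by
  have hC1 : 1 ≤ C := by
    obtain ⟨x, hx⟩ := hC.exists
    exact (one_le_opNorm _).trans hx
  have hlogC : 0 ≤ Real.log C := Real.log_nonneg hC1
  have key : ∀ α : ℝ, 0 < α → ∀ᵐ x ∂μ, ∀ᶠ n : ℕ in atTop,
      Real.log (opNorm (iterFwd T A n x)) ≤ 2 * α * n := by
    intro α hα
    rw [ae_iff]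
    refine le_antisymm (le_of_forall_gt fun c hc => ?_) zero_le
    obtain ⟨ε, hε, hεc⟩ : ∃ ε : ℝ, 0 < ε ∧ ENNReal.ofReal ε < c := by
      obtain ⟨d, hd0, hdc⟩ := exists_between hc
      have hd : d ≠ ∞ := (hdc.trans_le le_top).ne
      exact ⟨d.toReal, ENNReal.toReal_pos hd0.ne' hd, by rwa [ENNReal.ofReal_toReal hd]⟩
    obtain ⟨N, hN, hgrowth⟩ := h (ε * α) (by positivity)
    have hN' : (0 : ℝ) < N := by exact_mod_cast hN
    have hmax := measure_exists_lt_birkhoffSum_le (hT.iterate N)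
      (measurable_log_opNorm (stronglyMeasurable_iterFwd (T := T) hA N))
      (integrable_log_opNorm_iterFwd hT hA hC N) (fun x => log_opNorm_nonneg _)
      (α := N * α) (by positivity)
    refine lt_of_le_of_lt (le_trans (measure_mono_ae ?_) hmax) (lt_of_le_of_lt ?_ hεc)
    · filter_upwards [ae_forall_iterate hT hC] with x hx hnot
      by_contra hsmall
      apply hnot
      have hsmall' : ∀ k : ℕ, birkhoffSum (T^[N])
          (fun x => Real.log (opNorm (iterFwd T A N x))) k x ≤ k * (N * α) := by
        intro k
        by_contra! hlt
        exact hsmall ⟨k, hlt⟩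
      obtain ⟨n₀, hn₀⟩ := exists_nat_ge (N * Real.log C / α)
      filter_upwards [eventually_ge_atTop n₀] with n hn
      have h1 := (log_opNorm_iterFwd_mul_le T A N (n / N) x).trans (hsmall' (n / N))
      have h2 : Real.log (opNorm (iterFwd T A (n % N) (T^[N * (n / N)] x))) ≤ N * Real.log C := by
        refine (log_opNorm_iterFwd_le (C := C) (fun i => ?_) _).trans ?_
        · rw [← Function.iterate_add_apply]; exact hx _
        · gcongr
          exact (Nat.mod_lt n hN).le
      have h3 := log_opNorm_mul_le (iterFwd T A (n % N) (T^[N * (n / N)] x))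
        (iterFwd T A (N * (n / N)) x)
      rw [← iterFwd_add, Nat.div_add_mod] at h3
      have h4 : N * Real.log C ≤ α * n := by
        rw [div_le_iff₀ hα] at hn₀
        have : (n₀ : ℝ) ≤ n := by exact_mod_cast hn
        nlinarith
      have h5 : ((n / N : ℕ) : ℝ) * (N * α) ≤ α * n := by
        have : ((n / N * N : ℕ) : ℝ) ≤ n := by exact_mod_cast Nat.div_mul_le_self n N
        push_cast at this
        nlinarith
      linarith
    · apply ENNReal.ofReal_le_ofReal
      rw [div_le_iff₀ (by positivity)]
      change growth μ T A N ≤ _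
      linarith
  refine ⟨fun _ => 0, ?_, integrable_zero _ _ _, integral_zero _ _⟩
  have hall : ∀ᵐ x ∂μ, ∀ m : ℕ, ∀ᶠ n : ℕ in atTop,
      Real.log (opNorm (iterFwd T A n x)) ≤ 2 * (1 / ((m : ℝ) + 1)) * n :=
    ae_all_iff.2 fun m => key _ (by positivity)
  filter_upwards [hall] with x hx
  rw [Metric.tendsto_atTop']
  intro ε hε
  obtain ⟨m, hm⟩ := exists_nat_one_div_lt (show 0 < ε / 2 by positivity)
  obtain ⟨n₀, hn₀⟩ := eventually_atTop.1 (hx m)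
  refine ⟨n₀, fun n hn => ?_⟩
  have hn0 : (0 : ℝ) < n := by exact_mod_cast (Nat.zero_le n₀).trans_lt hn
  rw [Real.dist_eq, sub_zero]
  change |1 / (n : ℝ) * Real.log (opNorm (iterFwd T A n x))| < ε
  rw [abs_of_nonneg (mul_nonneg (by positivity) (log_opNorm_nonneg _)), one_div,
    inv_mul_lt_iff₀ hn0]
  refine (hn₀ n hn.le).trans_lt ?_
  nlinarith

/-! ### Genericity -/

theorem LinftySL.ae_norm_sub_le_dist {μ : Measure X} (A B : LinftySL μ) :
    ∀ᵐ x ∂μ, ‖(A x : Matrix (Fin 2) (Fin 2) ℝ) - (B x : Matrix (Fin 2) (Fin 2) ℝ)‖ ≤ dist A B := by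
  filter_upwards [ae_le_eLpNormEssSup (μ := μ) (f := fun x =>
    (A x : Matrix (Fin 2) (Fin 2) ℝ) - (B x : Matrix (Fin 2) (Fin 2) ℝ))] with x hx
  rw [LinftySL.dist_def, ← toReal_enorm]
  exact ENNReal.toReal_mono (LinftySL.essSup_ne_top A B) hx

theorem norm_seqProd_sub_le {A B : ℕ → SL(2, ℝ)} {D d : ℝ} (hD : 1 ≤ D)
    (hA : ∀ i, opNorm (A i) ≤ D) (hB : ∀ i, opNorm (B i) ≤ D)
    (hd : ∀ i, ‖(A i : Matrix (Fin 2) (Fin 2) ℝ) - (B i : Matrix (Fin 2) (Fin 2) ℝ)‖ ≤ d)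
    (n : ℕ) : ‖(seqProd A n : Matrix (Fin 2) (Fin 2) ℝ) - (seqProd B n : Matrix (Fin 2) (Fin 2) ℝ)‖
      ≤ n * D ^ n * d := by
  have hd0 : 0 ≤ d := (norm_nonneg _).trans (hd 0)
  induction n with
  | zero => simp [seqProd]
  | succ n ih =>
    have e : (seqProd A (n + 1) : Matrix (Fin 2) (Fin 2) ℝ)
        - (seqProd B (n + 1) : Matrix (Fin 2) (Fin 2) ℝ)
        = ((A n : Matrix (Fin 2) (Fin 2) ℝ) - (B n : Matrix (Fin 2) (Fin 2) ℝ))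
            * (seqProd A n : Matrix (Fin 2) (Fin 2) ℝ)
          + (B n : Matrix (Fin 2) (Fin 2) ℝ) * ((seqProd A n : Matrix (Fin 2) (Fin 2) ℝ)
            - (seqProd B n : Matrix (Fin 2) (Fin 2) ℝ)) := by
      rw [seqProd, seqProd, Matrix.SpecialLinearGroup.coe_mul, Matrix.SpecialLinearGroup.coe_mul]
      noncomm_ring
    rw [e]
    have h1 : ‖((A n : Matrix (Fin 2) (Fin 2) ℝ) - (B n : Matrix (Fin 2) (Fin 2) ℝ))
        * (seqProd A n : Matrix (Fin 2) (Fin 2) ℝ)‖ ≤ d * D ^ n :=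
      (Matrix.l2_opNorm_mul _ _).trans
        (mul_le_mul (hd n) (opNorm_seqProd_le fun i _ => hA i) (norm_nonneg _) hd0)
    have h2 : ‖(B n : Matrix (Fin 2) (Fin 2) ℝ) * ((seqProd A n : Matrix (Fin 2) (Fin 2) ℝ)
        - (seqProd B n : Matrix (Fin 2) (Fin 2) ℝ))‖ ≤ D * (n * D ^ n * d) :=
      (Matrix.l2_opNorm_mul _ _).trans (mul_le_mul (hB n) ih (norm_nonneg _) (by linarith))
    refine (norm_add_le _ _).trans ((add_le_add h1 h2).trans ?_)
    have h3 : d * D ^ n ≤ D ^ (n + 1) * d := by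
      rw [mul_comm]
      gcongr
      omega
    push_cast
    calc d * D ^ n + D * (n * D ^ n * d) ≤ D ^ (n + 1) * d + D * (n * D ^ n * d) := by gcongr
      _ = _ := by ring

theorem isOpen_growth_lt {μ : Measure X} [IsProbabilityMeasure μ] {T : X ≃ᵐ X}
    (hT : MeasurePreserving T μ μ) (n : ℕ) (c : ℝ) :
    IsOpen {A : LinftySL μ | growth μ T A n < c} := by
  rw [Metric.isOpen_iff]
  intro A hA
  obtain ⟨C, hC, hAC⟩ := A.exists_opNorm_le
  have hL : 0 < n * (C + 1) ^ n + 1 := by positivity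
  have hgap : 0 < c - growth μ T A n := sub_pos.2 hA
  refine ⟨min 1 ((c - growth μ T A n) / (n * (C + 1) ^ n + 1)), by positivity, fun B hB => ?_⟩
  rw [Metric.mem_ball, dist_comm, lt_min_iff, lt_div_iff₀ hL] at hB
  have hdist := A.ae_norm_sub_le_dist B
  have hBC : ∀ᵐ x ∂μ, opNorm (B x) ≤ C + 1 := by
    filter_upwards [hAC, hdist] with x h1 h2
    have h3 := norm_sub_norm_le (B x : Matrix (Fin 2) (Fin 2) ℝ) (A x : Matrix (Fin 2) (Fin 2) ℝ)
    rw [norm_sub_rev] at h3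
    have h4 := hB.1
    change ‖(B x : Matrix (Fin 2) (Fin 2) ℝ)‖ ≤ _
    change ‖(A x : Matrix (Fin 2) (Fin 2) ℝ)‖ ≤ _ at h1
    linarith
  have hle : growth μ T B n ≤ growth μ T A n + n * (C + 1) ^ n * dist A B := by
    have hiA := integrable_log_opNorm_iterFwd hT A.stronglyMeasurable hAC n
    have hiB := integrable_log_opNorm_iterFwd hT B.stronglyMeasurable hBC n
    calc growth μ T B n ≤ ∫ x, (Real.log (opNorm (iterFwd T A n x))
          + n * (C + 1) ^ n * dist A B) ∂μ := by
          refine integral_mono_ae hiB (hiA.add (integrable_const _)) ?_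
          filter_upwards [ae_forall_iterate hT hAC, ae_forall_iterate hT hBC,
            ae_forall_iterate hT hdist] with x h1 h2 h3
          have h4 := norm_seqProd_sub_le (A := orbitSeq T A x) (B := orbitSeq T B x)
            (by linarith : 1 ≤ C + 1) (fun i => (h1 i).trans (by linarith)) h2 h3 n
          rw [← iterFwd_eq_seqProd, ← iterFwd_eq_seqProd, norm_sub_rev] at h4
          have h5 := norm_sub_norm_le (iterFwd T B n x : Matrix (Fin 2) (Fin 2) ℝ)
            (iterFwd T A n x : Matrix (Fin 2) (Fin 2) ℝ)
          have hb := opNorm_pos (iterFwd T B n x)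
          have ha := one_le_opNorm (iterFwd T A n x)
          have ha0 := opNorm_pos (iterFwd T A n x)
          -- `log b - log a ≤ b / a - 1 ≤ b - a`
          have h6 := Real.log_le_sub_one_of_pos (div_pos hb ha0)
          rw [Real.log_div hb.ne' ha0.ne'] at h6
          have h7 : opNorm (iterFwd T B n x) / opNorm (iterFwd T A n x) - 1
              ≤ n * (C + 1) ^ n * dist A B := by
            rw [sub_le_iff_le_add, div_le_iff₀ ha0]
            have h8 : 0 ≤ n * (C + 1) ^ n * dist A B := (norm_nonneg _).trans h4
            nlinarith
          linarith
      _ = _ := by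
          rw [integral_add hiA (integrable_const _), integral_const, probReal_univ, one_smul]
          rfl
  have h9 := hB.2
  change growth μ T B n < c
  nlinarith [dist_nonneg (x := A) (y := B)]

end SLCocycle

theorem theoremB {X : Type*} [MeasurableSpace X] (μ : MeasureTheory.Measure X)
    [MeasureTheory.IsProbabilityMeasure μ] (hμ : SLCocycle.IsNonatomic μ)
    (T : X ≃ᵐ X) (hT : Ergodic T μ) :
    ∃ R : Set (SLCocycle.LinftySL μ), R ∈ residual (SLCocycle.LinftySL μ) ∧
      ∀ A ∈ R, SLCocycle.IsUniformlyHyperbolic μ T A ∨ SLCocycle.HasLE μ T A 0 := by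
  have hTm := hT.toMeasurePreserving
  set U : ℕ → Set (SLCocycle.LinftySL μ) := fun m =>
    {A | ∃ n : ℕ, 0 < n ∧ SLCocycle.growth μ T A n < n * (1 / ((m : ℝ) + 1))} with hU
  have hUo : ∀ m, IsOpen (U m) := by
    intro m
    have : U m = ⋃ n : ℕ, ⋃ _ : 0 < n,
        {A : SLCocycle.LinftySL μ | SLCocycle.growth μ T A n < n * (1 / ((m : ℝ) + 1))} := by
      ext A; simp [hU]
    rw [this]
    exact isOpen_iUnion fun n => isOpen_iUnion fun _ => SLCocycle.isOpen_growth_lt hTm n _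
  refine ⟨⋂ m, (U m ∪ (closure (U m))ᶜ), ?_, fun A hA => ?_⟩
  · refine countable_iInter_mem.2 fun m => residual_of_dense_open
      ((hUo m).union isClosed_closure.isOpen_compl) ?_
    rw [dense_iff_closure_eq, Set.eq_univ_iff_forall]
    intro A
    by_cases h : A ∈ closure (U m)
    · exact closure_mono Set.subset_union_left h
    · exact subset_closure (Or.inr h)
  · rw [Set.mem_iInter] at hA
    by_cases hUH : SLCocycle.IsUniformlyHyperbolic μ T A
    · exact Or.inl hUH
    right
    obtain ⟨C, -, hC⟩ := A.exists_opNorm_le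
    refine SLCocycle.hasLE_zero_of_growth_lt hTm A.stronglyMeasurable hC fun ε hε => ?_
    obtain ⟨m, hm⟩ := exists_nat_one_div_lt hε
    -- a cocycle that is not uniformly hyperbolic is in the closure of each `U m`
    have hcl : A ∈ closure (U m) := by
      refine Metric.mem_closure_iff.2 fun r hr => ?_
      obtain ⟨B, hB, hBn⟩ := SLCocycle.exists_dist_lt_growth_lt hμ hT A hUH hr
        (ε := 1 / ((m : ℝ) + 1)) (by positivity)
      exact ⟨B, hBn, hB⟩
    obtain ⟨n, hn, hlt⟩ := (hA m).resolve_right (not_not.2 hcl)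
    have hn' : (0 : ℝ) < n := by exact_mod_cast hn
    exact ⟨n, hn, hlt.trans (by gcongr)⟩
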